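/- Let $Y$ be a nonempty closed oriented Riemannian manifold of dimension $n\ge 2$, let $G$ be a compact Lie group of dimension $d>0$ with Lie algebra $\mathfrak g$, and let $P\to Y$ be a principal $G$-bundle with adjoint bundle $\operatorname{ad}(P)$ and space of connections $\mathcal A(P)$. Let $I\subseteq\mathbb R$ be a nonempty open interval and $$(A,\omega,\Psi)\in C^\infty\bigl(I,\ \mathcal A(P)\times\Omega^{n-2}(Y,\operatorname{ad}(P))\times\Omega^0(Y,\operatorname{ad}(P))\bigr).$$ Let $\nabla_s=\partial_s+[\Psi\wedge\,\cdot\,]$, let $d_A$ be the exterior covariant derivative and let $d_A^*=-\ast d_A\ast$ be its formal adjoint on $1$-forms. Consider the first order linear differential operator $\nabla_s+B_{(A,\omega,\Psi)}$ acting on triples $(\alpha,v,\psi)\in C^\infty(I,\Omega^1(Y,\operatorname{ad}(P))\times\Omega^{n-2}(Y,\operatorname{ad}(P))\times\Omega^0(Y,\operatorname{ad}(P)))$ by $$(\nabla_s+B_{(A,\omega,\Psi)})\begin{pmatrix}\alpha\\ v\\ \psi\end{pmatrix}=\begin{pmatrix}\nabla_s\alpha+\ast[\omega\wedge\alpha]+(-1)^{n+1}\ast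 d_Av-d_A\psi\\ \nabla_sv+\ast d_A\alpha-v-[\omega\wedge\psi]\\ \nabla_s\psi-d_A^*\alpha+\ast[\omega\wedge\ast v]\end{pmatrix}.$$ This is the linearization, at $(A,\omega,\Psi)$, of the elliptic Yang–Mills flow $\partial_sA-d_A\Psi+(-1)^{n+1}\ast d_A\omega=0$, $\partial_s\omega+[\Psi,\omega]-\omega+\ast F_A=0$, augmented by a gauge-fixing component. Then this operator is elliptic on $I\times Y$ (that is, its principal symbol at every nonzero real covector of $I\times Y$ is an isomorphism) if and only if $n=2$. -/

import Mathlib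

open scoped Manifold ContDiff Bundle Nat
open Bundle Module

noncomputable section

/-! ### Instances on tangent spaces and on the Lie algebra of a Lie group -/

section Instances

/-- A `C^∞` real Lie group has the regularity that Mathlib asks for in order to equip its tangent
space at the identity with the Lie algebra structure. -/
instance lieGroupMinSmoothness {d : ℕ} {G : Type*} [TopologicalSpace G]
    [ChartedSpace (EuclideanSpace ℝ (Fin d)) G] [Group G] [LieGroup (𝓡 d) ∞ G] :
    LieGroup (𝓡 d) (minSmoothness ℝ 3) G :=
  LieGroup.of_le (n := ∞) (by
    rw [minSmoothness_of_isRCLikeNormedField]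
    exact WithTop.coe_le_coe.2 le_top)

variable {d : ℕ} {G : Type*} [TopologicalSpace G]
    [ChartedSpace (EuclideanSpace ℝ (Fin d)) G] [Group G]

/-- A norm on the finite-dimensional Lie algebra of `G` (the one of the model space). It is used
only through its topology, which is the canonical one. -/
instance lieAlgebraNormedAddCommGroup : NormedAddCommGroup (GroupLieAlgebra (𝓡 d) G) :=
  inferInstanceAs (NormedAddCommGroup (EuclideanSpace ℝ (Fin d)))

instance lieAlgebraNormedSpace : NormedSpace ℝ (GroupLieAlgebra (𝓡 d) G) :=
  inferInstanceAs (NormedSpace ℝ (EuclideanSpace ℝ (Fin d)))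

instance tangentSpaceFiniteDimensional {n : ℕ} {Y : Type*} [TopologicalSpace Y]
    [ChartedSpace (EuclideanSpace ℝ (Fin n)) Y] (y : Y) :
    FiniteDimensional ℝ (TangentSpace (𝓡 n) y) :=
  inferInstanceAs (FiniteDimensional ℝ (EuclideanSpace ℝ (Fin n)))

instance tangentSpaceFinrank {n : ℕ} {Y : Type*} [TopologicalSpace Y]
    [ChartedSpace (EuclideanSpace ℝ (Fin n)) Y] (y : Y) :
    Fact (finrank ℝ (TangentSpace (𝓡 n) y) = n) :=
  ⟨(finrank_euclideanSpace_fin : finrank ℝ (EuclideanSpace ℝ (Fin n)) = n)⟩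

end Instances

/-! ### The Hodge star on an oriented Euclidean vector space -/

section Hodge

variable {V : Type*} [NormedAddCommGroup V] [InnerProductSpace ℝ V]
  {W : Type*} [NormedAddCommGroup W] [NormedSpace ℝ W]
  {n k l : ℕ}

/-- The Euclidean volume form of an oriented Euclidean space of dimension `n`. -/
def volForm [Fact (finrank ℝ V = n)] (o : Orientation ℝ V (Fin n)) : V [⋀^Fin n]→L[ℝ] ℝ :=
  o.volumeForm.mkContinuous 1 (fun v => by
    simpa using o.abs_volumeForm_apply_le v)

theorem append_update {α : Type*} (u : Fin k → α) (v : Fin l → α) (i : Fin l) (x : α) :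
    Fin.append u (Function.update v i x) =
      Function.update (Fin.append u v) (Fin.natAdd k i) x := by
  funext j
  refine Fin.addCases (fun a => ?_) (fun a => ?_) j
  · rw [Function.update_of_ne (by
      intro h
      have := congrArg Fin.val h
      simp at this
      omega)]
    simp
  · by_cases h : a = i
    · subst h; simp
    · rw [Function.update_of_ne (by simpa using h)]
      simp [h]

/-- The `l`-form `μ(u₁, …, u_k, · , …, ·)`, for an `n`-form `μ` with `n = k + l`. -/
def insertLeft (h : k + l = n) (μ : V [⋀^Fin n]→L[ℝ] ℝ) (u : Fin k → V) :
    V [⋀^Fin l]→L[ℝ] ℝ where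
  toFun v := μ (fun i => Fin.append u v (Fin.cast h.symm i))
  map_update_add' := by
    intro inst v i x y
    obtain rfl : inst = instDecidableEqFin _ := Subsingleton.elim _ _
    subst h
    have key : ∀ z, (fun j => Fin.append u (Function.update v i z) (Fin.cast rfl j)) =
        Function.update (Fin.append u v) (Fin.natAdd k i) z := append_update u v i
    simp only [key]
    exact μ.map_update_add _ _ _ _
  map_update_smul' := by
    intro inst v i c x
    obtain rfl : inst = instDecidableEqFin _ := Subsingleton.elim _ _
    subst h
    have key : ∀ z, (fun j => Fin.append u (Function.update v i z) (Fin.cast rfl j)) =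
        Function.update (Fin.append u v) (Fin.natAdd k i) z := append_update u v i
    simp only [key]
    exact μ.map_update_smul _ _ _ _
  map_eq_zero_of_eq' := by
    intro v i j hv hij
    subst h
    refine μ.map_eq_zero_of_eq (i := Fin.natAdd k i) (j := Fin.natAdd k j) _ ?_ ?_
    · simpa using hv
    · simpa using hij
  cont := by
    subst h
    refine μ.cont.comp (continuous_pi fun i => ?_)
    refine Fin.addCases (fun j => ?_) (fun j => ?_) i
    · simpa using continuous_const
    · simpa using continuous_apply j

/-- The Hodge star `Λ^k V^* ⊗ W → Λ^l V^* ⊗ W`, `k + l = n`, of an oriented Euclidean space of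
dimension `n`:
`(⋆α)(v₁,…,v_l) = (1/k!) ∑ α(e_{i₁},…,e_{i_k}) vol(e_{i₁},…,e_{i_k},v₁,…,v_l)`, the sum being over
all `i₁,…,i_k` for an orthonormal basis `e` (the result does not depend on the basis). Thus
`e^I ∧ ⋆e^I = vol`. -/
def hodgeStar [Fact (finrank ℝ V = n)] [FiniteDimensional ℝ V] (o : Orientation ℝ V (Fin n))
    (h : k + l = n) (α : V [⋀^Fin k]→L[ℝ] W) : V [⋀^Fin l]→L[ℝ] W :=
  (k ! : ℝ)⁻¹ • ∑ f : Fin k → Fin (finrank ℝ V),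
    (insertLeft h (volForm o) (fun i => stdOrthonormalBasis ℝ V (f i))).smulRight
      (α (fun i => stdOrthonormalBasis ℝ V (f i)))

end Hodge

/-! ### The wedge bracket of Lie algebra valued forms, and the adjoint representation -/

section LieAlgebraForms

variable {d : ℕ} {G : Type*} [TopologicalSpace G]
    [ChartedSpace (EuclideanSpace ℝ (Fin d)) G] [Group G] [LieGroup (𝓡 d) ∞ G]
  {V : Type*} [AddCommGroup V] [Module ℝ V] [TopologicalSpace V]
  {k l m : ℕ}

/-- The adjoint action of `h : G` on the Lie algebra: the derivative at `1` of `x ↦ h x h⁻¹`. -/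
def Ad (h : G) : GroupLieAlgebra (𝓡 d) G →L[ℝ] GroupLieAlgebra (𝓡 d) G :=
  mfderiv (𝓡 d) (𝓡 d) (fun x : G => h * x * h⁻¹) 1

theorem continuous_lieBracket :
    Continuous (fun q : GroupLieAlgebra (𝓡 d) G × GroupLieAlgebra (𝓡 d) G => ⁅q.1, q.2⁆) := by
  have : FiniteDimensional ℝ (GroupLieAlgebra (𝓡 d) G) := inferInstance
  let B : GroupLieAlgebra (𝓡 d) G →ₗ[ℝ] GroupLieAlgebra (𝓡 d) G →ₗ[ℝ] GroupLieAlgebra (𝓡 d) G :=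
    LinearMap.mk₂ ℝ (fun x y => ⁅x, y⁆) (fun _ _ _ => add_lie _ _ _) (fun _ _ _ => smul_lie _ _ _)
      (fun _ _ _ => lie_add _ _ _) (fun _ _ _ => lie_smul _ _ _)
  exact (LinearMap.toContinuousBilinearMap B).continuous₂

section Update

variable {α : Type*} (v : Fin (k + l) → α) (x : α)

theorem update_castAdd_castAdd (j : Fin k) :
    (fun i => Function.update v (Fin.castAdd l j) x (Fin.castAdd l i)) =
      Function.update (fun i => v (Fin.castAdd l i)) j x := by
  funext i
  by_cases h : i = j
  · subst h; simp
  · rw [Function.update_of_ne (by simpa using h), Function.update_of_ne h]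

theorem update_natAdd_natAdd (j : Fin l) :
    (fun i => Function.update v (Fin.natAdd k j) x (Fin.natAdd k i)) =
      Function.update (fun i => v (Fin.natAdd k i)) j x := by
  funext i
  by_cases h : i = j
  · subst h; simp
  · rw [Function.update_of_ne (by simpa using h), Function.update_of_ne h]

theorem update_castAdd_natAdd (j : Fin k) :
    (fun i => Function.update v (Fin.castAdd l j) x (Fin.natAdd k i)) =
      fun i => v (Fin.natAdd k i) := by
  funext i
  rw [Function.update_of_ne (by
    intro h
    have := congrArg Fin.val h
    simp at this
    omega)]

theorem update_natAdd_castAdd (j : Fin l) :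
    (fun i => Function.update v (Fin.natAdd k j) x (Fin.castAdd l i)) =
      fun i => v (Fin.castAdd l i) := by
  funext i
  rw [Function.update_of_ne (by
    intro h
    have := congrArg Fin.val h
    simp at this
    omega)]

end Update

/-- The multilinear map `v ↦ [a(v₁,…,v_k), b(v_{k+1},…,v_{k+l})]`. -/
def bracketMul (a : V [⋀^Fin k]→L[ℝ] GroupLieAlgebra (𝓡 d) G)
    (b : V [⋀^Fin l]→L[ℝ] GroupLieAlgebra (𝓡 d) G) :
    ContinuousMultilinearMap ℝ (fun _ : Fin (k + l) => V) (GroupLieAlgebra (𝓡 d) G) where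
  toFun v := ⁅a (fun i => v (Fin.castAdd l i)), b (fun i => v (Fin.natAdd k i))⁆
  map_update_add' := by
    intro inst v i x y
    obtain rfl : inst = instDecidableEqFin _ := Subsingleton.elim _ _
    refine Fin.addCases (fun j => ?_) (fun j => ?_) i
    · simp only [update_castAdd_castAdd, update_castAdd_natAdd, a.map_update_add, add_lie]
    · simp only [update_natAdd_castAdd, update_natAdd_natAdd, b.map_update_add, lie_add]
  map_update_smul' := by
    intro inst v i c x
    obtain rfl : inst = instDecidableEqFin _ := Subsingleton.elim _ _
    refine Fin.addCases (fun j => ?_) (fun j => ?_) i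
    · simp only [update_castAdd_castAdd, update_castAdd_natAdd, a.map_update_smul, smul_lie]
    · simp only [update_natAdd_castAdd, update_natAdd_natAdd, b.map_update_smul, lie_smul]
  cont := by
    refine continuous_lieBracket.comp (Continuous.prodMk
      (a.cont.comp (continuous_pi fun i => continuous_apply _))
      (b.cont.comp (continuous_pi fun i => continuous_apply _)))

/-- `[a ∧ b]` for Lie algebra valued alternating forms `a`, `b` of degrees `k`, `l`:
`[a ∧ b](v₁,…,v_{k+l}) = (1/(k! l!)) ∑_σ sgn σ [a(v_{σ1},…,v_{σk}), b(v_{σ(k+1)},…,v_{σ(k+l)})]`. -/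
def wedgeBracket (h : k + l = m) (a : V [⋀^Fin k]→L[ℝ] GroupLieAlgebra (𝓡 d) G)
    (b : V [⋀^Fin l]→L[ℝ] GroupLieAlgebra (𝓡 d) G) :
    V [⋀^Fin m]→L[ℝ] GroupLieAlgebra (𝓡 d) G :=
  ((k ! * l ! : ℕ) : ℝ)⁻¹ • ((bracketMul a b).domDomCongr (finCongr h)).alternatization

end LieAlgebraForms

/-! ### Differential forms on a manifold -/

section Forms

/-- Not necessarily continuous `F`-valued differential forms of degree `k` on an `m`-manifold. -/
abbrev MForm (m : ℕ) (M : Type*) [TopologicalSpace M] [ChartedSpace (EuclideanSpace ℝ (Fin m)) M]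
    (F : Type*) [NormedAddCommGroup F] [NormedSpace ℝ F] (k : ℕ) :=
  ∀ x : M, TangentSpace (𝓡 m) x [⋀^Fin k]→L[ℝ] F

variable {m k : ℕ} {M : Type*} [TopologicalSpace M] [ChartedSpace (EuclideanSpace ℝ (Fin m)) M]
  {F : Type*} [NormedAddCommGroup F] [NormedSpace ℝ F]

/-- The expression of a form in the chart around `x₀`, i.e. its pull-back under the inverse of
the chart. Only its values on the target of the chart are meaningful. -/
def chartForm (α : MForm m M F k) (x₀ : M) (u : EuclideanSpace ℝ (Fin m)) :
    EuclideanSpace ℝ (Fin m) [⋀^Fin k]→L[ℝ] F :=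
  (α ((extChartAt (𝓡 m) x₀).symm u)).compContinuousLinearMap
    ((mfderiv (𝓡 m) (𝓡 m) (extChartAt (𝓡 m) x₀).symm u).comp
      (NormedSpace.fromTangentSpace (𝕜 := ℝ) u).symm.toContinuousLinearMap)

/-- A family of forms on `M`, parametrized by `s ∈ I ⊆ ℝ`, is smooth jointly in `(s, x)`: all its
chart expressions are. -/
def SmoothFormsOn (I : Set ℝ) (α : ℝ → MForm m M F k) : Prop :=
  ∀ x₀ : M, ContDiffOn ℝ ∞
    (fun q : ℝ × EuclideanSpace ℝ (Fin m) => chartForm (α q.1) x₀ q.2)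
    (I ×ˢ (extChartAt (𝓡 m) x₀).target)

/-- A form is smooth if its chart expressions are. -/
def SmoothForm (α : MForm m M F k) : Prop :=
  ∀ x₀ : M, ContDiffOn ℝ ∞ (chartForm α x₀) (extChartAt (𝓡 m) x₀).target

/-- The exterior derivative of a form on a manifold, computed at `x` in the chart around `x`. -/
def mExtDeriv (α : MForm m M F k) : MForm m M F (k + 1) := fun x =>
  (extDeriv (chartForm α x) (extChartAt (𝓡 m) x x)).compContinuousLinearMap
    ((NormedSpace.fromTangentSpace (𝕜 := ℝ) (extChartAt (𝓡 m) x x)).toContinuousLinearMap.comp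
      (mfderiv (𝓡 m) (𝓡 m) (extChartAt (𝓡 m) x) x))

/-- An orientation of a Riemannian manifold: a choice of an orientation of every tangent space
which is locally constant, i.e. for which the Riemannian volume form is smooth. -/
def IsManifoldOrientation [RiemannianBundle (fun y : M => TangentSpace (𝓡 m) y)]
    (o : ∀ y : M, Orientation ℝ (TangentSpace (𝓡 m) y) (Fin m)) : Prop :=
  SmoothForm (F := ℝ) (k := m) (fun y : M => volForm (o y))

end Forms

/-! ### Principal bundles, connections, and forms with values in the adjoint bundle -/

section Bundles

variable {n d : ℕ}
  {Y : Type*} [TopologicalSpace Y] [ChartedSpace (EuclideanSpace ℝ (Fin n)) Y]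
  {G : Type*} [TopologicalSpace G] [ChartedSpace (EuclideanSpace ℝ (Fin d)) G] [Group G]
  {P : Type*} [TopologicalSpace P] [ChartedSpace (EuclideanSpace ℝ (Fin (n + d))) P]
  [MulAction Gᵐᵒᵖ P]

/-- `pr : P → Y` is a smooth principal `G`-bundle; the right action `(p, g) ↦ p · g` of `G` on `P`
is written as a left action of the opposite group. -/
structure IsPrincipalBundle (n d : ℕ) {Y : Type*} [TopologicalSpace Y]
    [ChartedSpace (EuclideanSpace ℝ (Fin n)) Y] (G : Type*) [TopologicalSpace G]
    [ChartedSpace (EuclideanSpace ℝ (Fin d)) G] [Group G] {P : Type*} [TopologicalSpace P]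
    [ChartedSpace (EuclideanSpace ℝ (Fin (n + d))) P] [MulAction Gᵐᵒᵖ P] (pr : P → Y) :
    Prop where
  contMDiff_act : ContMDiff ((𝓡 (n + d)).prod (𝓡 d)) (𝓡 (n + d)) ∞
    (fun q : P × G => MulOpposite.op q.2 • q.1)
  contMDiff_proj : ContMDiff (𝓡 (n + d)) (𝓡 n) ∞ pr
  proj_act : ∀ (p : P) (g : G), pr (MulOpposite.op g • p) = pr p
  /-- Every point of the base has an open neighbourhood `U` with a diffeomorphism
  `pr⁻¹(U) ≅ U × G` over `U` that is equivariant for the right actions. -/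
  locally_trivial : ∀ y : Y, ∃ (U : Set Y)
    (Φ : PartialDiffeomorph (𝓡 (n + d)) ((𝓡 n).prod (𝓡 d)) P (Y × G) ∞),
    IsOpen U ∧ y ∈ U ∧ Φ.source = pr ⁻¹' U ∧ Φ.target = U ×ˢ Set.univ ∧
    ∀ p ∈ Φ.source, (Φ p).1 = pr p ∧
      ∀ g : G, Φ (MulOpposite.op g • p) = ((Φ p).1, (Φ p).2 * g)

/-- Principal connections, given by their connection `1`-form `A : TP → 𝔤`: it sends fundamental
vector fields to their generators and is equivariant, `R_g^* A = Ad(g⁻¹) A`. (Smoothness is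
required separately.) -/
structure IsConnectionForm
    (A : ∀ p : P, TangentSpace (𝓡 (n + d)) p →L[ℝ] GroupLieAlgebra (𝓡 d) G) : Prop where
  fundamental : ∀ (p : P) (X : GroupLieAlgebra (𝓡 d) G),
    A (MulOpposite.op (1 : G) • p)
      (mfderiv (𝓡 d) (𝓡 (n + d)) (fun g : G => MulOpposite.op g • p) 1 X) = X
  equivariant : ∀ (p : P) (g : G) (w : TangentSpace (𝓡 (n + d)) p),
    A (MulOpposite.op g • p)
      (mfderiv (𝓡 (n + d)) (𝓡 (n + d)) (fun q : P => MulOpposite.op g • q) p w) =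
      Ad g⁻¹ (A p w)

/-- A path `I → 𝒜(P)` of smooth connections, smooth jointly in `s` and the point of `P`. -/
structure IsSmoothConnectionPath (I : Set ℝ)
    (A : ℝ → ∀ p : P, TangentSpace (𝓡 (n + d)) p →L[ℝ] GroupLieAlgebra (𝓡 d) G) : Prop where
  isConnection : ∀ s ∈ I, IsConnectionForm (A s)
  smooth : SmoothFormsOn (m := n + d) (k := 1) I (fun s p =>
    ContinuousAlternatingMap.ofSubsingleton ℝ (TangentSpace (𝓡 (n + d)) p)
      (GroupLieAlgebra (𝓡 d) G) (0 : Fin 1) (A s p))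

/-- The alternating `k`-forms on `T_{pr(p)}Y` with values in `𝔤`. The point `p` of the fibre `P_y`
identifies `𝔤` with the fibre of `ad(P)` over `y = pr(p)`, and hence this space with the fibre over
`y` of `Λ^k T^*Y ⊗ ad(P)`. -/
abbrev AdFibre (n d : ℕ) {Y : Type*} [TopologicalSpace Y]
    [ChartedSpace (EuclideanSpace ℝ (Fin n)) Y] {P : Type*} (G : Type*) [TopologicalSpace G] [ChartedSpace (EuclideanSpace ℝ (Fin d)) G]
    [Group G] (pr : P → Y) (k : ℕ) (p : P) :=
  TangentSpace (𝓡 n) (pr p) [⋀^Fin k]→L[ℝ] GroupLieAlgebra (𝓡 d) G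

/-- A form of degree `k` on `Y` with values in `ad(P) = P ×_G 𝔤`, given as a function on `P`; see
`IsAdForm` for the equivariance. -/
abbrev AdForm (n d : ℕ) {Y : Type*} [TopologicalSpace Y]
    [ChartedSpace (EuclideanSpace ℝ (Fin n)) Y] {P : Type*} (G : Type*) [TopologicalSpace G] [ChartedSpace (EuclideanSpace ℝ (Fin d)) G]
    [Group G] (pr : P → Y) (k : ℕ) :=
  ∀ p : P, AdFibre n d G pr k p

/-- The horizontal `𝔤`-valued form on `P` corresponding to an `ad(P)`-valued form on `Y`. -/
def pullbackForm (pr : P → Y) {k : ℕ} (α : AdForm n d G pr k) :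
    MForm (n + d) P (GroupLieAlgebra (𝓡 d) G) k :=
  fun p => (α p).compContinuousLinearMap (mfderiv (𝓡 (n + d)) (𝓡 n) pr p)

/-- Equivariance: `R_g^* α = Ad(g⁻¹) α` for the corresponding form on `P`. -/
def IsAdForm (pr : P → Y) {k : ℕ} (α : AdForm n d G pr k) : Prop :=
  ∀ (p : P) (g : G) (w : Fin k → TangentSpace (𝓡 (n + d)) p),
    pullbackForm pr α (MulOpposite.op g • p)
      (fun i => mfderiv (𝓡 (n + d)) (𝓡 (n + d)) (fun q : P => MulOpposite.op g • q) p (w i)) =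
      Ad g⁻¹ (pullbackForm pr α p w)

/-- A path `I → Ω^k(Y, ad(P))`, smooth jointly in `s` and the point. -/
structure IsSmoothAdPath (pr : P → Y) (I : Set ℝ) {k : ℕ} (α : ℝ → AdForm n d G pr k) : Prop where
  isAdForm : ∀ s ∈ I, IsAdForm pr (α s)
  smooth : SmoothFormsOn I (fun s => pullbackForm pr (α s))

/-- The horizontal lift `T_{pr(p)}Y → T_pP` of a connection: the inverse of
`(dpr, A) : T_pP ≅ T_{pr(p)}Y × 𝔤`, restricted to `T_{pr(p)}Y × 0`. -/
def horizontalLift (pr : P → Y)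
    (A : ∀ p : P, TangentSpace (𝓡 (n + d)) p →L[ℝ] GroupLieAlgebra (𝓡 d) G) (p : P) :
    TangentSpace (𝓡 n) (pr p) →L[ℝ] TangentSpace (𝓡 (n + d)) p :=
  ((mfderiv (𝓡 (n + d)) (𝓡 n) pr p).prod (A p)).inverse.comp
    (ContinuousLinearMap.inl ℝ (TangentSpace (𝓡 n) (pr p)) (GroupLieAlgebra (𝓡 d) G))

/-- The exterior covariant derivative `d_A`: the exterior derivative of the corresponding form on
`P`, evaluated on horizontal lifts. -/
def covExtDeriv (pr : P → Y)
    (A : ∀ p : P, TangentSpace (𝓡 (n + d)) p →L[ℝ] GroupLieAlgebra (𝓡 d) G)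
    {k : ℕ} (α : AdForm n d G pr k) : AdForm n d G pr (k + 1) :=
  fun p => (mExtDeriv (pullbackForm pr α) p).compContinuousLinearMap (horizontalLift pr A p)

end Bundles

/-! ### The linearized operator and its ellipticity -/

section Operator

variable {n d : ℕ}
  {Y : Type*} [TopologicalSpace Y] [ChartedSpace (EuclideanSpace ℝ (Fin n)) Y]
  {G : Type*} [TopologicalSpace G] [ChartedSpace (EuclideanSpace ℝ (Fin d)) G] [Group G]
  {P : Type*} [TopologicalSpace P] [ChartedSpace (EuclideanSpace ℝ (Fin (n + d))) P]
  [MulAction Gᵐᵒᵖ P]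

/-- The fibre of `(T^*Y ⊕ Λ^{n-2} T^*Y ⊕ Λ^0 T^*Y) ⊗ ad(P)` over `pr(p)`, seen from `p`. -/
abbrev TripleFibre (n d : ℕ) {Y : Type*} [TopologicalSpace Y]
    [ChartedSpace (EuclideanSpace ℝ (Fin n)) Y] {P : Type*} (G : Type*) [TopologicalSpace G] [ChartedSpace (EuclideanSpace ℝ (Fin d)) G]
    [Group G] (pr : P → Y) (p : P) :=
  AdFibre n d G pr 1 p × AdFibre n d G pr (n - 2) p × AdFibre n d G pr 0 p

/-- Time-dependent triples `(α, v, ψ)`. -/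
abbrev TripleField (n d : ℕ) {Y : Type*} [TopologicalSpace Y]
    [ChartedSpace (EuclideanSpace ℝ (Fin n)) Y] {P : Type*} (G : Type*) [TopologicalSpace G] [ChartedSpace (EuclideanSpace ℝ (Fin d)) G]
    [Group G] (pr : P → Y) :=
  ℝ → ∀ p : P, TripleFibre n d G pr p

/-- `(α, v, ψ) ∈ C^∞(I, Ω^1(Y, ad P) × Ω^{n-2}(Y, ad P) × Ω^0(Y, ad P))`: the smooth sections over
`I × Y` of the bundle on which the operator acts. -/
structure IsSmoothTriple (pr : P → Y) (I : Set ℝ) (u : TripleField n d G pr) : Prop where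
  fst : IsSmoothAdPath pr I (fun s p => (u s p).1)
  snd : IsSmoothAdPath pr I (fun s p => (u s p).2.1)
  thd : IsSmoothAdPath pr I (fun s p => (u s p).2.2)

/-- An operator `D` of first order on sections over `I × Y` is elliptic if its principal symbol at
every nonzero real covector is a linear isomorphism. The symbol at the covector `df` at
`(s, y)`, where `f` is a function vanishing at `(s, y)`, is the map `u(s, y) ↦ D(f u)(s, y)`;
every covector is such a `df`. -/
def IsElliptic (pr : P → Y) (I : Set ℝ) (D : TripleField n d G pr → TripleField n d G pr) : Prop :=
  ∀ s ∈ I, ∀ p : P, ∀ f : ℝ × Y → ℝ,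
    ContMDiff ((𝓘(ℝ, ℝ)).prod (𝓡 n)) 𝓘(ℝ, ℝ) ∞ f → f (s, pr p) = 0 →
    mfderiv ((𝓘(ℝ, ℝ)).prod (𝓡 n)) 𝓘(ℝ, ℝ) f (s, pr p) ≠ 0 →
    ∃ σ : TripleFibre n d G pr p ≃ₗ[ℝ] TripleFibre n d G pr p,
      ∀ u : TripleField n d G pr, IsSmoothTriple pr I u →
        D (fun t q => f (t, pr q) • u t q) s p = σ (u s p)

variable [LieGroup (𝓡 d) ∞ G]

/-- `∇_s α = ∂_s α + [Ψ ∧ α]`. -/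
def nablaS (pr : P → Y) (Ψ : ℝ → AdForm n d G pr 0) {k : ℕ} (α : ℝ → AdForm n d G pr k) :
    ℝ → AdForm n d G pr k :=
  fun s p => deriv (fun t => α t p) s + wedgeBracket (Nat.zero_add k) (Ψ s p) (α s p)

variable [RiemannianBundle (fun y : Y => TangentSpace (𝓡 n) y)]

/-- The Hodge star on `ad(P)`-valued forms on `Y`. -/
def adStar (pr : P → Y) (o : ∀ y : Y, Orientation ℝ (TangentSpace (𝓡 n) y) (Fin n))
    {k l : ℕ} (h : k + l = n) (α : AdForm n d G pr k) : AdForm n d G pr l :=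
  fun p => hodgeStar (o (pr p)) h (α p)

/-- The formal adjoint `d_A^* = - ⋆ d_A ⋆` of `d_A` on `1`-forms. -/
def covCoderiv (hn : 2 ≤ n) (pr : P → Y)
    (o : ∀ y : Y, Orientation ℝ (TangentSpace (𝓡 n) y) (Fin n))
    (A : ∀ p : P, TangentSpace (𝓡 (n + d)) p →L[ℝ] GroupLieAlgebra (𝓡 d) G)
    (α : AdForm n d G pr 1) : AdForm n d G pr 0 :=
  -adStar pr o (show n - 1 + 1 + 0 = n by omega)
    (covExtDeriv pr A (adStar pr o (show 1 + (n - 1) = n by omega) α))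

/-- The operator `∇_s + B_{(A,ω,Ψ)}`, the linearization of
`(A, ω, Ψ) ↦ (∂_s A - d_A Ψ + (-1)^{n+1} ⋆ d_A ω, ∂_s ω + [Ψ, ω] - ω + ⋆ F_A)`,
augmented by the gauge-fixing component:
* `α`-component: `∇_s α + ⋆[ω ∧ α] + (-1)^{n+1} ⋆ d_A v - d_A ψ`;
* `v`-component: `∇_s v + ⋆ d_A α - v - [ω ∧ ψ]`;
* `ψ`-component: `∇_s ψ - d_A^* α + ⋆[ω ∧ ⋆v]`.

For `n = 2` one has `⋆[ω ∧ ⋆v] = [ω ∧ v]`. -/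
def linearizedOperator (hn : 2 ≤ n) (pr : P → Y)
    (o : ∀ y : Y, Orientation ℝ (TangentSpace (𝓡 n) y) (Fin n))
    (A : ℝ → ∀ p : P, TangentSpace (𝓡 (n + d)) p →L[ℝ] GroupLieAlgebra (𝓡 d) G)
    (om : ℝ → AdForm n d G pr (n - 2)) (Ψ : ℝ → AdForm n d G pr 0)
    (u : TripleField n d G pr) : TripleField n d G pr :=
  let α : ℝ → AdForm n d G pr 1 := fun s p => (u s p).1
  let v : ℝ → AdForm n d G pr (n - 2) := fun s p => (u s p).2.1
  let ψ : ℝ → AdForm n d G pr 0 := fun s p => (u s p).2.2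
  fun s p =>
    (nablaS pr Ψ α s p
        + hodgeStar (o (pr p)) (show n - 2 + 1 + 1 = n by omega)
            (wedgeBracket (rfl : n - 2 + 1 = n - 2 + 1) (om s p) (α s p))
        + (-1 : ℝ) ^ (n + 1) • adStar pr o (show n - 2 + 1 + 1 = n by omega)
            (covExtDeriv pr (A s) (v s)) p
        - covExtDeriv pr (A s) (ψ s) p,
      nablaS pr Ψ v s p
        + adStar pr o (show 1 + 1 + (n - 2) = n by omega) (covExtDeriv pr (A s) (α s)) p
        - v s p
        - wedgeBracket (Nat.add_zero (n - 2)) (om s p) (ψ s p),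
      nablaS pr Ψ ψ s p
        - covCoderiv hn pr o (A s) (α s) p
        + hodgeStar (o (pr p)) (Nat.add_zero n)
            (wedgeBracket (show n - 2 + 2 = n by omega) (om s p)
              (hodgeStar (o (pr p)) (show n - 2 + 2 = n by omega) (v s p))))

end Operator

end

/-! At a zero of `f` the operator applied to `f u` keeps only its first order terms, and `d_A`
contributes the exterior product with the differential of `f`. With `τ` and `ξ` the time and space
parts of that differential, the symbol is therefore (α, v, ψ) ↦ (τα + (-1)^(n+1) ⋆(ξ ∧ v) - ξψ, τv +
⋆(ξ ∧ α), τψ + ⋆(ξ ∧ ⋆α)). This comes from `linearizedOperator_smul_of_eq_zero` and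
`covExtDeriv_smul_of_eq_zero`.

For n = 2 all of this is scalar in an orthonormal frame: the symbol is τ + S(ξ), with S(ξ) a
skew-symmetric 4×4 matrix acting on 𝔤⁴ and S(ξ)² = -|ξ|². Hence (τ - S)(τ + S) = τ² + |ξ|², which is
nonzero (`planarSymbol_planarSymbol`, `covector_components_ne_zero`).

For n ≥ 3 the form v has positive degree, so it can be divisible by ξ. Take τ = 0, ξ = dx₁ and v =
X₀ ⊗ dx₁ ∧ … ∧ dx_{n-2}. Then ξ ∧ v = 0, and (0, v, 0) is a nonzero kernel vector.

Two points need work. The symbol is tested on global smooth sections, so the kernel vector must be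
extended to an equivariant form on all of P; this uses a bump function, a local trivialization and
the smoothness of `Ad` (`exists_section`). Also, the Hodge star is defined by orthonormal bases
chosen separately at each point, so the continuity of ⋆α is not visible from its formula. The
product rule at a zero of `f` needs no more than continuity, which follows from the frame-free
identity `volForm_smul_hodgeStar`. -/

noncomputable section

/-! ### Product rules at a zero, and forms determined by finitely many values -/

section Calculus

open Filter Topology

variable {E W : Type*} [NormedAddCommGroup E] [NormedSpace ℝ E]
  [NormedAddCommGroup W] [NormedSpace ℝ W]

/-- The error term f(y)(g(y) - g(x)) is O(‖y - x‖) · o(1), so `g` need not be differentiable. This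
is what allows ⋆α, known only to be continuous, inside `d_A`. -/
theorem hasFDerivAt_smul_of_eq_zero {f : E → ℝ} {f' : E →L[ℝ] ℝ} {g : E → W} {x : E}
    (hf : HasFDerivAt f f' x) (hx : f x = 0) (hg : ContinuousAt g x) :
    HasFDerivAt (fun y => f y • g y) (f'.smulRight (g x)) x := by
  have h1 : HasFDerivAt (fun y => f y • g x) (f'.smulRight (g x)) x := hf.smul_const (g x)
  have h2 : HasFDerivAt (fun y => f y • (g y - g x)) (0 : E →L[ℝ] W) x := by
    refine HasFDerivAt.of_isLittleO ?_
    have hO : f =O[𝓝 x] fun y => y - x := by simpa [hx] using hf.isBigO_sub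
    have ho : (fun y => g y - g x) =o[𝓝 x] fun _ => (1 : ℝ) := by
      rw [Asymptotics.isLittleO_one_iff]
      simpa using hg.tendsto.sub_const (g x)
    have h := hO.norm_right.smul_isLittleO ho
    refine (h.congr_right (g₂ := fun y => ‖y - x‖) fun y => by simp).of_norm_right.congr_left
      fun y => by simp
  convert h1.add h2 using 1
  · funext y
    simp [← smul_add]
  · simp

theorem extDeriv_smul_of_eq_zero {k : ℕ} {f : E → ℝ} {f' : E →L[ℝ] ℝ} {g : E → E [⋀^Fin k]→L[ℝ] W}
    {x : E} (hf : HasFDerivAt f f' x) (hx : f x = 0) (hg : ContinuousAt g x)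
    (w : Fin (k + 1) → E) :
    extDeriv (fun y => f y • g y) x w =
      ∑ i : Fin (k + 1), (-1 : ℤ) ^ (i : ℕ) • f' (w i) • g x (i.removeNth w) := by
  rw [extDeriv, (hasFDerivAt_smul_of_eq_zero hf hx hg).fderiv]
  simp [ContinuousAlternatingMap.alternatizeUncurryFin_apply]

theorem deriv_smul_of_eq_zero {f : ℝ → ℝ} {f' : ℝ} {g : ℝ → W} {x : ℝ}
    (hf : HasDerivAt f f' x) (hx : f x = 0) (hg : ContinuousAt g x) :
    deriv (fun y => f y • g y) x = f' • g x := by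
  have h := (hasFDerivAt_smul_of_eq_zero hf.hasFDerivAt hx hg).hasDerivAt.deriv
  simpa using h

variable {V F : Type*} [NormedAddCommGroup V] [NormedSpace ℝ V] [FiniteDimensional ℝ V]
  [NormedAddCommGroup F] [NormedSpace ℝ F] [FiniteDimensional ℝ F]

/-- Alternating forms on a finite-dimensional space are continuous linear functions of their
values on tuples of basis vectors. -/
theorem exists_eval_leftInverse (V F : Type*) [NormedAddCommGroup V] [NormedSpace ℝ V]
    [FiniteDimensional ℝ V] [NormedAddCommGroup F] [NormedSpace ℝ F] [FiniteDimensional ℝ F]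
    (k : ℕ) :
    ∃ S : ((Fin k → Fin (finrank ℝ V)) → F) →L[ℝ] V [⋀^Fin k]→L[ℝ] F,
      ∀ α : V [⋀^Fin k]→L[ℝ] F, S (fun j => α fun i => finBasis ℝ V (j i)) = α := by
  let T : (V [⋀^Fin k]→L[ℝ] F) →ₗ[ℝ] ((Fin k → Fin (finrank ℝ V)) → F) :=
    { toFun := fun α j => α fun i => finBasis ℝ V (j i)
      map_add' := fun _ _ => rfl
      map_smul' := fun _ _ => rfl }
  have hT : LinearMap.ker T = ⊥ := by
    rw [LinearMap.ker_eq_bot']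
    intro α hα
    refine ContinuousAlternatingMap.toAlternatingMap_injective
      (AlternatingMap.coe_multilinearMap_injective ?_)
    refine Basis.ext_multilinear (fun _ => finBasis ℝ V) fun j => ?_
    exact congrFun hα j
  obtain ⟨S, hS⟩ := LinearMap.exists_leftInverse_of_injective T hT
  exact ⟨S.toContinuousLinearMap, fun α => LinearMap.congr_fun hS α⟩

/-- A form is recovered from finitely many of its values by a continuous linear map, so pointwise
continuity already gives continuity in norm. -/
theorem continuousAt_alternating {X : Type*} [TopologicalSpace X] {k : ℕ}
    {f : X → V [⋀^Fin k]→L[ℝ] F} {x : X} (h : ∀ w : Fin k → V, ContinuousAt (fun y => f y w) x) :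
    ContinuousAt f x := by
  obtain ⟨S, hS⟩ := exists_eval_leftInverse V F k
  have := S.continuous.continuousAt.comp
    (continuousAt_pi.2 fun j => h fun i => finBasis ℝ V (j i))
  simpa [Function.comp_def, hS] using this

theorem contDiffOn_alternating {k : ℕ} {f : E → V [⋀^Fin k]→L[ℝ] F} {s : Set E}
    (h : ∀ w : Fin k → V, ContDiffOn ℝ ∞ (fun y => f y w) s) : ContDiffOn ℝ ∞ f s := by
  obtain ⟨S, hS⟩ := exists_eval_leftInverse V F k
  have := S.contDiff.comp_contDiffOn
    (contDiffOn_pi.2 fun j => h fun i => finBasis ℝ V (j i))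
  simpa [Function.comp_def, hS] using this

end Calculus

/-! ### The Hodge star in dimension two -/

section Planar

theorem alternating_swap {V W : Type*} [NormedAddCommGroup V] [NormedSpace ℝ V]
    [NormedAddCommGroup W] [NormedSpace ℝ W] (η : V [⋀^Fin 2]→L[ℝ] W) (x y : V) :
    η ![y, x] = - η ![x, y] := by
  have h := η.toAlternatingMap.map_swap ![x, y] (i := 0) (j := 1) (by decide)
  refine Eq.trans (congrArg η ?_) h
  funext i
  fin_cases i <;> rfl

variable {V : Type*} [NormedAddCommGroup V] [InnerProductSpace ℝ V] [Fact (finrank ℝ V = 2)]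
  {W : Type*} [NormedAddCommGroup W] [NormedSpace ℝ W]

/-- Each factor is a 2×2 determinant in one oriented orthonormal frame, and the product of the two
is a Gram determinant, in which the orientation cancels. -/
theorem volForm_mul_volForm (o : Orientation ℝ V (Fin 2)) (a b c d : V) :
    volForm o ![a, b] * volForm o ![c, d] =
      inner ℝ a c * inner ℝ b d - inner ℝ a d * inner ℝ b c := by
  have hf : finrank ℝ V = 2 := Fact.out
  let e := o.finOrthonormalBasis two_pos hf
  have he : o.volumeForm = e.toBasis.det :=
    o.volumeForm_robust e (o.finOrthonormalBasis_orientation two_pos hf)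
  have hv : ∀ x y : V, volForm o ![x, y] =
      inner ℝ (e 0) x * inner ℝ (e 1) y - inner ℝ (e 1) x * inner ℝ (e 0) y := by
    intro x y
    change o.volumeForm ![x, y] = _
    rw [he, Basis.det_apply, Matrix.det_fin_two]
    simp [Basis.toMatrix_apply, OrthonormalBasis.repr_apply_apply]
    ring
  have hi : ∀ x y : V, inner ℝ x y =
      inner ℝ (e 0) x * inner ℝ (e 0) y + inner ℝ (e 1) x * inner ℝ (e 1) y := by
    intro x y
    rw [← e.sum_inner_mul_inner x y, Fin.sum_univ_two, real_inner_comm x, real_inner_comm x]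
  rw [hv, hv, hi a c, hi b d, hi a d, hi b c]
  ring

variable [FiniteDimensional ℝ V]

variable (V) in
/-- The orthonormal basis used in the definition of the Hodge star, indexed by `Fin 2`. -/
def planarBasis : OrthonormalBasis (Fin 2) ℝ V :=
  (stdOrthonormalBasis ℝ V).reindex (finCongr Fact.out)

theorem hodgeStar_apply_planar {k l : ℕ} (o : Orientation ℝ V (Fin 2)) (h : k + l = 2)
    (α : V [⋀^Fin k]→L[ℝ] W) (w : Fin l → V) :
    hodgeStar o h α w = (k ! : ℝ)⁻¹ • ∑ f : Fin k → Fin 2,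
      volForm o (fun i => Fin.append (fun j => planarBasis V (f j)) w (Fin.cast h.symm i)) •
        α (fun i => planarBasis V (f i)) := by
  have : hodgeStar o h α w = (k ! : ℝ)⁻¹ • ∑ f : Fin k → Fin (finrank ℝ V),
      volForm o (fun i => Fin.append (fun j => stdOrthonormalBasis ℝ V (f j)) w
        (Fin.cast h.symm i)) • α (fun i => stdOrthonormalBasis ℝ V (f i)) := by
    simp only [hodgeStar, ContinuousAlternatingMap.smul_apply, ContinuousAlternatingMap.sum_apply]
    rfl
  rw [this]
  congr 1
  refine Fintype.sum_equiv ((Equiv.refl (Fin k)).arrowCongr (finCongr Fact.out)) _ _ fun f => ?_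
  simp [planarBasis]

theorem hodgeStar_one_apply (o : Orientation ℝ V (Fin 2)) (h : 1 + 1 = 2)
    (β : V [⋀^Fin 1]→L[ℝ] W) (w : V) :
    hodgeStar o h β ![w] = volForm o ![planarBasis V 0, w] • β ![planarBasis V 0] +
      volForm o ![planarBasis V 1, w] • β ![planarBasis V 1] := by
  have key : ∀ x : V, (fun i => Fin.append (fun _ : Fin 1 => x) ![w] (Fin.cast h.symm i)) =
      ![x, w] := by
    intro x
    funext i
    fin_cases i <;> rfl
  have key' : ∀ x : V, (fun _ : Fin 1 => x) = ![x] := by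
    intro x
    funext i
    fin_cases i
    rfl
  rw [hodgeStar_apply_planar, Fintype.sum_equiv (Equiv.funUnique (Fin 1) (Fin 2)) _
    (fun i => volForm o ![planarBasis V i, w] • β ![planarBasis V i])]
  · simp [Fin.sum_univ_two]
  · intro f
    have : f = fun _ => f 0 := by
      funext i
      rw [Subsingleton.elim i 0]
    rw [this, key, key']
    rfl

theorem hodgeStar_two_apply (o : Orientation ℝ V (Fin 2)) (h : 1 + 1 + 0 = 2)
    (γ : V [⋀^Fin (1 + 1)]→L[ℝ] W) (w : Fin 0 → V) :
    hodgeStar o h γ w =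
      volForm o ![planarBasis V 0, planarBasis V 1] • γ ![planarBasis V 0, planarBasis V 1] := by
  have key : ∀ x : Fin 2 → V, (fun i => Fin.append x w (Fin.cast h.symm i)) = x := by
    intro x
    funext i
    fin_cases i <;> rfl
  have key' : ∀ f : Fin 2 → Fin 2, (fun i => planarBasis V (f i)) =
      ![planarBasis V (f 0), planarBasis V (f 1)] := by
    intro f
    funext i
    fin_cases i <;> rfl
  have hz : ∀ x : V, volForm o ![x, x] = 0 := fun x =>
    (volForm o).map_eq_zero_of_eq ![x, x] (i := 0) (j := 1) rfl (by decide)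
  rw [hodgeStar_apply_planar, Fintype.sum_equiv (finTwoArrowEquiv (Fin 2)) _
    (fun i => volForm o ![planarBasis V i.1, planarBasis V i.2] •
      γ ![planarBasis V i.1, planarBasis V i.2])]
  · rw [Fintype.sum_prod_type]
    simp only [Fin.sum_univ_two, hz, alternating_swap _ (planarBasis V 0) (planarBasis V 1)]
    -- The diagonal terms vanish; exchanging the two basis vectors changes both signs, so the
    -- off-diagonal terms agree and their sum cancels the factor 1/2!.
    have h2 : ∀ z : W, (((1 + 1)! : ℕ) : ℝ)⁻¹ • (z + z) = z := fun z => by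
      rw [← two_smul ℝ z, smul_smul]
      norm_num [Nat.factorial]
    rw [zero_smul, zero_smul, zero_add, add_zero, neg_smul, smul_neg, neg_neg, h2]
  · intro f
    rw [key]
    simp only [key']
    rfl

/-- The frame need not be positively oriented: its volume is a sign ε, and only ε² = 1 is used. -/
theorem volForm_planarBasis_sq (o : Orientation ℝ V (Fin 2)) :
    volForm o ![planarBasis V 0, planarBasis V 1] *
      volForm o ![planarBasis V 0, planarBasis V 1] = 1 := by
  rw [volForm_mul_volForm]
  have h := orthonormal_iff_ite.1 (planarBasis V).orthonormal
  simp [h]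

/-- The Hodge star of a `1`-form in terms of any two vectors. -/
theorem volForm_smul_hodgeStar (o : Orientation ℝ V (Fin 2)) (h : 1 + 1 = 2)
    (β : V [⋀^Fin 1]→L[ℝ] W) (x y w : V) :
    volForm o ![x, y] • hodgeStar o h β ![w] =
      inner ℝ w y • β ![x] - inner ℝ w x • β ![y] := by
  have hβ : ∀ z : V, β ![z] = inner ℝ (planarBasis V 0) z • β ![planarBasis V 0] +
      inner ℝ (planarBasis V 1) z • β ![planarBasis V 1] := by
    intro z
    let L := (ContinuousAlternatingMap.ofSubsingleton ℝ V W (0 : Fin 1)).symm β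
    have hL : ∀ z, β ![z] = L z := by
      intro z
      change _ = β _
      congr 1
      funext i
      fin_cases i
      rfl
    simp only [hL]
    conv_lhs => rw [← (planarBasis V).sum_repr' z]
    simp [Fin.sum_univ_two]
  -- The Gram identity turns every product of volumes into inner products; both sides then become
  -- combinations of the two frame values of `β`.
  rw [hodgeStar_one_apply, smul_add, smul_smul, smul_smul, volForm_mul_volForm,
    volForm_mul_volForm, hβ x, hβ y, real_inner_comm (planarBasis V 0) x, real_inner_comm (planarBasis V 0) y,
    real_inner_comm w x, real_inner_comm w y, real_inner_comm (planarBasis V 1) x,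
    real_inner_comm (planarBasis V 1) y]
  module

end Planar

/-! ### Forms on a manifold and their exterior derivative at the centre of a chart -/

section ManifoldForms

variable {m k : ℕ} {M : Type*} [TopologicalSpace M] [ChartedSpace (EuclideanSpace ℝ (Fin m)) M]
  {F : Type*} [NormedAddCommGroup F] [NormedSpace ℝ F]

/-- The tangent space at `x` is the model space read in the preferred chart at `x`, so that chart
has the identity as derivative at its own centre. -/
theorem mfderiv_extChartAt_symm_self [IsManifold (𝓡 m) ∞ M] (x : M)
    (w : EuclideanSpace ℝ (Fin m)) :
    (mfderiv (𝓡 m) (𝓡 m) (extChartAt (𝓡 m) x).symm (extChartAt (𝓡 m) x x) w :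
      EuclideanSpace ℝ (Fin m)) = w := by
  have h := mfderivWithin_range_extChartAt_symm (I := 𝓡 m) (x := x)
  rw [ModelWithCorners.range_eq_univ, mfderivWithin_univ] at h
  rw [h]
  rfl

theorem chartForm_self [IsManifold (𝓡 m) ∞ M] (α : MForm m M F k) (x : M)
    (w : Fin k → EuclideanSpace ℝ (Fin m)) :
    chartForm α x (extChartAt (𝓡 m) x x) w = α x w := by
  -- All tangent spaces are the model space by definition, so the propositional equality of base
  -- points can be substituted without a cast. The same device recurs below.
  have key : ∀ q : M, q = x → ∀ w : Fin k → EuclideanSpace ℝ (Fin m), α q w = α x w := by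
    rintro q rfl w
    rfl
  refine Eq.trans (key _ (extChartAt_to_inv (I := 𝓡 m) x) _) ?_
  congr 1
  funext i
  exact mfderiv_extChartAt_symm_self x (w i)

theorem mExtDeriv_apply [IsManifold (𝓡 m) ∞ M] (α : MForm m M F k) (x : M)
    (w : Fin (k + 1) → TangentSpace (𝓡 m) x) :
    mExtDeriv α x w = extDeriv (chartForm α x) (extChartAt (𝓡 m) x x) w := by
  have h := mfderiv_extChartAt_self (I := 𝓡 m) (x := x)
  refine congrArg (extDeriv (chartForm α x) (extChartAt (𝓡 m) x x)) ?_
  funext i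
  change (mfderiv (𝓡 m) (𝓡 m) (extChartAt (𝓡 m) x) x) (w i) = w i
  rw [h]
  rfl

theorem mExtDeriv_zero [IsManifold (𝓡 m) ∞ M] :
    mExtDeriv (fun _ => 0 : MForm m M F k) = fun _ => 0 := by
  funext x
  ext w
  rw [mExtDeriv_apply]
  have : chartForm (fun _ => 0 : MForm m M F k) x = 0 := rfl
  rw [this, extDeriv, fderiv_zero]
  exact DFunLike.congr_fun (ContinuousAlternatingMap.alternatizeUncurryFinCLM ℝ
    (EuclideanSpace ℝ (Fin m)) F (n := k)).map_zero w

/-- The differential of a function, as a linear form on the tangent space. -/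
def differential (f : M → ℝ) (x : M) : TangentSpace (𝓡 m) x →L[ℝ] ℝ :=
  mfderiv (𝓡 m) 𝓘(ℝ, ℝ) f x

theorem hasFDerivAt_comp_extChartAt_symm {f : M → ℝ} {x : M}
    (hf : MDifferentiableAt (𝓡 m) 𝓘(ℝ, ℝ) f x) :
    HasFDerivAt (fun u => f ((extChartAt (𝓡 m) x).symm u))
      (differential f x : EuclideanSpace ℝ (Fin m) →L[ℝ] ℝ)
      (extChartAt (𝓡 m) x x) := by
  have h := hf.hasMFDerivAt.2
  rw [ModelWithCorners.range_eq_univ] at h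
  exact HasFDerivWithinAt.hasFDerivAt_of_univ h

/-- The Leibniz rule at a zero of the function. -/
theorem mExtDeriv_smul_of_eq_zero [IsManifold (𝓡 m) ∞ M] {f : M → ℝ} {α : MForm m M F k} {x : M}
    (hf : MDifferentiableAt (𝓡 m) 𝓘(ℝ, ℝ) f x) (hx : f x = 0)
    (hα : ContinuousAt (chartForm α x) (extChartAt (𝓡 m) x x))
    (w : Fin (k + 1) → EuclideanSpace ℝ (Fin m)) :
    mExtDeriv (fun q => f q • α q) x w =
      ∑ i : Fin (k + 1), (-1 : ℤ) ^ (i : ℕ) •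
        differential f x (w i) • (α x (i.removeNth w) : F) := by
  have h := extDeriv_smul_of_eq_zero (hasFDerivAt_comp_extChartAt_symm hf)
    (by simpa using hx) hα w
  simp only [chartForm_self] at h
  exact (mExtDeriv_apply _ x w).trans h

theorem SmoothFormsOn.continuousAt_space {I : Set ℝ} {α : ℝ → MForm m M F k}
    (h : SmoothFormsOn I α) (hI : IsOpen I) {s : ℝ} (hs : s ∈ I) (x : M) :
    ContinuousAt (chartForm (α s) x) (extChartAt (𝓡 m) x x) := by
  have h1 := (h x).continuousOn.continuousAt (x := (s, extChartAt (𝓡 m) x x))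
    (prod_mem_nhds (hI.mem_nhds hs) (extChartAt_target_mem_nhds x))
  exact h1.comp (f := fun u => (s, u)) (by fun_prop)

theorem SmoothFormsOn.continuousAt_time {I : Set ℝ} {α : ℝ → MForm m M F k}
    (h : SmoothFormsOn I α) (hI : IsOpen I) {s : ℝ} (hs : s ∈ I) (x : M) :
    ContinuousAt (fun t => chartForm (α t) x (extChartAt (𝓡 m) x x)) s := by
  have h1 := (h x).continuousOn.continuousAt (x := (s, extChartAt (𝓡 m) x x))
    (prod_mem_nhds (hI.mem_nhds hs) (extChartAt_target_mem_nhds x))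
  exact h1.comp (f := fun t => (t, extChartAt (𝓡 m) x x)) (by fun_prop)

end ManifoldForms

/-! ### Horizontal lifts and the symbol of the covariant derivative -/

section PrincipalBundles

/-- To reach (y, X), lift y to any w and correct it by the vertical vector `B (X - A w)`;
surjectivity and equal dimensions give bijectivity. Invertibility matters because
`ContinuousLinearMap.inverse`, used in `horizontalLift`, is 0 on a non-invertible map. -/
theorem isInvertible_prod {E F W : Type*} [NormedAddCommGroup E] [NormedSpace ℝ E]
    [NormedAddCommGroup F] [NormedSpace ℝ F] [NormedAddCommGroup W] [NormedSpace ℝ W]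
    [FiniteDimensional ℝ E] [FiniteDimensional ℝ F] [FiniteDimensional ℝ W]
    (hdim : finrank ℝ E = finrank ℝ F + finrank ℝ W) {L : E →L[ℝ] F} {A : E →L[ℝ] W}
    {B : W →L[ℝ] E} (hL : Function.Surjective L) (hLB : ∀ X, L (B X) = 0)
    (hAB : ∀ X, A (B X) = X) : (L.prod A).IsInvertible := by
  have hsurj : Function.Surjective (L.prod A : E →L[ℝ] F × W) := by
    rintro ⟨y, X⟩
    obtain ⟨w, rfl⟩ := hL y
    refine ⟨w + B (X - A w), ?_⟩
    simp [hLB, hAB]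
  have hinj : Function.Injective (L.prod A : E →ₗ[ℝ] F × W) :=
    (LinearMap.injective_iff_surjective_of_finrank_eq_finrank (by simpa using hdim)).2 hsurj
  exact ⟨(LinearEquiv.ofBijective _ ⟨hinj, hsurj⟩).toContinuousLinearEquiv, rfl⟩

variable {n d : ℕ}
  {Y : Type*} [TopologicalSpace Y] [ChartedSpace (EuclideanSpace ℝ (Fin n)) Y]
  {G : Type*} [TopologicalSpace G] [ChartedSpace (EuclideanSpace ℝ (Fin d)) G] [Group G]
  {P : Type*} [TopologicalSpace P] [ChartedSpace (EuclideanSpace ℝ (Fin (n + d))) P]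
  [MulAction Gᵐᵒᵖ P] {pr : P → Y}

theorem IsPrincipalBundle.mdifferentiableAt_proj (hpr : IsPrincipalBundle n d G pr) (p : P) :
    MDifferentiableAt (𝓡 (n + d)) (𝓡 n) pr p :=
  (hpr.contMDiff_proj p).mdifferentiableAt (by simp)

theorem IsPrincipalBundle.surjective_proj (hpr : IsPrincipalBundle n d G pr) :
    Function.Surjective pr := by
  intro y
  obtain ⟨U, Φ, hU, hy, hs, ht, hΦ⟩ := hpr.locally_trivial y
  have hmem : (y, (1 : G)) ∈ Φ.target := by simp [ht, hy]
  refine ⟨Φ.symm (y, 1), ?_⟩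
  have h := (hΦ _ (Φ.map_target hmem)).1
  have h' := Φ.right_inv hmem
  exact h.symm.trans (congrArg Prod.fst h')

/-- A local section through `p`, constant in the fibre coordinate of a trivialization,
differentiates to a right inverse. -/
theorem IsPrincipalBundle.surjective_mfderiv (hpr : IsPrincipalBundle n d G pr) (p : P) :
    Function.Surjective (mfderiv (𝓡 (n + d)) (𝓡 n) pr p :
      EuclideanSpace ℝ (Fin (n + d)) →L[ℝ] EuclideanSpace ℝ (Fin n)) := by
  obtain ⟨U, Φ, hU, hy, hs, ht, hΦ⟩ := hpr.locally_trivial (pr p)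
  have hp : p ∈ Φ.source := by rw [hs]; exact hy
  let τ : Y → P := fun y => Φ.symm (y, (Φ p).2)
  have hτp : τ (pr p) = p := by
    have : (pr p, (Φ p).2) = Φ p := by rw [← (hΦ p hp).1]
    change Φ.symm (pr p, (Φ p).2) = p
    rw [this]
    exact Φ.left_inv hp
  have hτ : MDifferentiableAt (𝓡 n) (𝓡 (n + d)) τ (pr p) := by
    have h1 : MDifferentiableAt ((𝓡 n).prod (𝓡 d)) (𝓡 (n + d)) Φ.symm (pr p, (Φ p).2) :=
      Φ.symm.mdifferentiableAt (by simp) (show _ ∈ Φ.target by simp [ht, hy])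
    exact h1.comp (pr p) (mdifferentiableAt_id.prodMk mdifferentiableAt_const)
  have hprτ : pr ∘ τ =ᶠ[nhds (pr p)] id := by
    filter_upwards [hU.mem_nhds hy] with y hy'
    have hmem : (y, (Φ p).2) ∈ Φ.target := by simp [ht, hy']
    have h := (hΦ _ (Φ.map_target hmem)).1
    exact h.symm.trans (congrArg Prod.fst (Φ.right_inv hmem))
  have hd : MDifferentiableAt (𝓡 (n + d)) (𝓡 n) pr (τ (pr p)) := hpr.mdifferentiableAt_proj _
  have h := mfderiv_comp (pr p) hd hτ
  rw [hprτ.mfderiv_eq, mfderiv_id] at h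
  intro y
  have hq : ∀ q : P, q = p → (mfderiv (𝓡 (n + d)) (𝓡 n) pr q :
      EuclideanSpace ℝ (Fin (n + d)) →L[ℝ] EuclideanSpace ℝ (Fin n)) =
      mfderiv (𝓡 (n + d)) (𝓡 n) pr p := by
    rintro q rfl
    rfl
  refine ⟨mfderiv (𝓡 n) (𝓡 (n + d)) τ (pr p) y, ?_⟩
  rw [← hq _ hτp]
  exact (DFunLike.congr_fun h y).symm

/-- Here `B` is the derivative of the orbit map. It is vertical because `pr` is constant on orbits,
and `A` inverts it because a connection reproduces the generators of fundamental fields. -/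
theorem IsPrincipalBundle.isInvertible_prod_connection (hpr : IsPrincipalBundle n d G pr)
    [LieGroup (𝓡 d) ∞ G]
    {A : ∀ p : P, TangentSpace (𝓡 (n + d)) p →L[ℝ] GroupLieAlgebra (𝓡 d) G}
    (hA : IsConnectionForm A) (p : P) :
    ((mfderiv (𝓡 (n + d)) (𝓡 n) pr p).prod (A p)).IsInvertible := by
  let B : EuclideanSpace ℝ (Fin d) →L[ℝ] EuclideanSpace ℝ (Fin (n + d)) :=
    mfderiv (𝓡 d) (𝓡 (n + d)) (fun g : G => MulOpposite.op g • p) 1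
  have hone : MulOpposite.op (1 : G) • p = p := by simp
  have hact : MDifferentiableAt (𝓡 d) (𝓡 (n + d)) (fun g : G => MulOpposite.op g • p) 1 := by
    have h1 : MDifferentiableAt ((𝓡 (n + d)).prod (𝓡 d)) (𝓡 (n + d))
        (fun q : P × G => MulOpposite.op q.2 • q.1) (p, 1) :=
      (hpr.contMDiff_act (p, 1)).mdifferentiableAt (by simp)
    exact h1.comp (1 : G) (mdifferentiableAt_const.prodMk mdifferentiableAt_id)
  have hq : ∀ q : P, q = p → ∀ w : EuclideanSpace ℝ (Fin (n + d)),
      ((mfderiv (𝓡 (n + d)) (𝓡 n) pr q w : EuclideanSpace ℝ (Fin n)) =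
        mfderiv (𝓡 (n + d)) (𝓡 n) pr p w) ∧ A q w = A p w := by
    rintro q rfl w
    exact ⟨rfl, rfl⟩
  refine isInvertible_prod (E := EuclideanSpace ℝ (Fin (n + d))) (F := EuclideanSpace ℝ (Fin n))
    (W := GroupLieAlgebra (𝓡 d) G) (B := B) ?_ (hpr.surjective_mfderiv p) ?_ ?_
  · have : finrank ℝ (GroupLieAlgebra (𝓡 d) G) = d :=
      (finrank_euclideanSpace_fin : finrank ℝ (EuclideanSpace ℝ (Fin d)) = d)
    rw [this]
    simp
  · intro X
    have hd : MDifferentiableAt (𝓡 (n + d)) (𝓡 n) pr (MulOpposite.op (1 : G) • p) :=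
      hpr.mdifferentiableAt_proj _
    have h := mfderiv_comp (1 : G) hd hact
    have hc : pr ∘ (fun g : G => MulOpposite.op g • p) = fun _ => pr p := by
      funext g
      exact hpr.proj_act p g
    rw [hc, mfderiv_const] at h
    exact (hq _ hone _).1.symm.trans (DFunLike.congr_fun h X).symm
  · intro X
    exact (hq _ hone _).2.symm.trans (hA.fundamental p X)

theorem IsPrincipalBundle.mfderiv_horizontalLift (hpr : IsPrincipalBundle n d G pr)
    [LieGroup (𝓡 d) ∞ G]
    {A : ∀ p : P, TangentSpace (𝓡 (n + d)) p →L[ℝ] GroupLieAlgebra (𝓡 d) G}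
    (hA : IsConnectionForm A) (p : P) (w : TangentSpace (𝓡 n) (pr p)) :
    mfderiv (𝓡 (n + d)) (𝓡 n) pr p (horizontalLift pr A p w) = w := by
  have h := (hpr.isInvertible_prod_connection hA p).self_apply_inverse (w, 0)
  exact congrArg Prod.fst h

theorem IsPrincipalBundle.pullbackForm_horizontalLift (hpr : IsPrincipalBundle n d G pr)
    [LieGroup (𝓡 d) ∞ G]
    {A : ∀ p : P, TangentSpace (𝓡 (n + d)) p →L[ℝ] GroupLieAlgebra (𝓡 d) G}
    (hA : IsConnectionForm A) {k : ℕ} (α : AdForm n d G pr k) (p : P)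
    (w : Fin k → TangentSpace (𝓡 n) (pr p)) :
    pullbackForm pr α p (fun i => horizontalLift pr A p (w i)) = α p w :=
  congrArg (α p) (funext fun i => hpr.mfderiv_horizontalLift hA p (w i))

variable [IsManifold (𝓡 (n + d)) ∞ P]

omit [MulAction Gᵐᵒᵖ P] in
theorem covExtDeriv_zero
    (A : ∀ p : P, TangentSpace (𝓡 (n + d)) p →L[ℝ] GroupLieAlgebra (𝓡 d) G) {k : ℕ} :
    covExtDeriv pr A (fun _ => 0 : AdForm n d G pr k) = fun _ => 0 := by
  funext p
  have : pullbackForm pr (fun _ => 0 : AdForm n d G pr k) = fun _ => 0 := rfl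
  simp only [covExtDeriv, this, mExtDeriv_zero]
  rfl

/-- The principal symbol of `d_A`. -/
theorem IsPrincipalBundle.covExtDeriv_smul_of_eq_zero (hpr : IsPrincipalBundle n d G pr)
    [LieGroup (𝓡 d) ∞ G]
    {A : ∀ p : P, TangentSpace (𝓡 (n + d)) p →L[ℝ] GroupLieAlgebra (𝓡 d) G}
    (hA : IsConnectionForm A) {k : ℕ} {α : AdForm n d G pr k} {p : P} {f : Y → ℝ}
    (hf : MDifferentiableAt (𝓡 n) 𝓘(ℝ, ℝ) f (pr p)) (hp : f (pr p) = 0)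
    (hα : ContinuousAt (chartForm (pullbackForm pr α) p) (extChartAt (𝓡 (n + d)) p p))
    (w : Fin (k + 1) → TangentSpace (𝓡 n) (pr p)) :
    covExtDeriv pr A (fun q => f (pr q) • α q) p w =
      ∑ i : Fin (k + 1), (-1 : ℤ) ^ (i : ℕ) •
        differential f (pr p) (w i) • α p (i.removeNth w) := by
  have hfp : MDifferentiableAt (𝓡 (n + d)) 𝓘(ℝ, ℝ) (f ∘ pr) p :=
    hf.comp p (hpr.mdifferentiableAt_proj p)
  have h := mExtDeriv_smul_of_eq_zero hfp hp hα (fun i => horizontalLift pr A p (w i))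
  refine h.trans (Finset.sum_congr rfl fun i _ => ?_)
  congr 2
  · rw [differential, mfderiv_comp p hf (hpr.mdifferentiableAt_proj p)]
    exact congrArg (mfderiv (𝓡 n) 𝓘(ℝ, ℝ) f (pr p)) (hpr.mfderiv_horizontalLift hA p (w i))
  · exact hpr.pullbackForm_horizontalLift hA α p (i.removeNth w)

/-- Smoothness is imposed on the pulled-back form on P. Evaluating that form on the horizontal lifts
of one fixed connection recovers `α t p`. -/
theorem IsPrincipalBundle.continuousAt_time (hpr : IsPrincipalBundle n d G pr)
    [LieGroup (𝓡 d) ∞ G]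
    {A : ∀ p : P, TangentSpace (𝓡 (n + d)) p →L[ℝ] GroupLieAlgebra (𝓡 d) G}
    (hA : IsConnectionForm A) {k : ℕ} {I : Set ℝ} (hI : IsOpen I) {α : ℝ → AdForm n d G pr k}
    (hα : IsSmoothAdPath pr I α) {s : ℝ} (hs : s ∈ I) (p : P) :
    ContinuousAt (fun t => α t p) s := by
  refine continuousAt_alternating (V := EuclideanSpace ℝ (Fin n))
    (F := GroupLieAlgebra (𝓡 d) G) fun w => ?_
  have h := hα.smooth.continuousAt_time hI hs p
  let ev := ContinuousAlternatingMap.apply ℝ (EuclideanSpace ℝ (Fin (n + d)))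
    (GroupLieAlgebra (𝓡 d) G) (fun i => horizontalLift pr A p (w i))
  have h1 : ContinuousAt (fun t => chartForm (pullbackForm pr (α t)) p
      (extChartAt (𝓡 (n + d)) p p) (fun i => horizontalLift pr A p (w i))) s :=
    ev.continuous.continuousAt.comp h
  refine h1.congr (Filter.Eventually.of_forall fun t => ?_)
  exact (chartForm_self _ p _).trans (hpr.pullbackForm_horizontalLift hA (α t) p w)

end PrincipalBundles

/-! ### Continuity of the Hodge star of a 1-form on a surface -/

section ContinuityOfHodgeStar

open Filter Topology

theorem isContinuousRiemannianBundle_tangent {n : ℕ} {Y : Type*} [TopologicalSpace Y]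
    [ChartedSpace (EuclideanSpace ℝ (Fin n)) Y] [IsManifold (𝓡 n) ∞ Y]
    [RiemannianBundle (fun y : Y => TangentSpace (𝓡 n) y)]
    [IsContMDiffRiemannianBundle (𝓡 n) ∞ (EuclideanSpace ℝ (Fin n))
      (fun y : Y => TangentSpace (𝓡 n) y)] :
    IsContinuousRiemannianBundle (EuclideanSpace ℝ (Fin n))
      (fun y : Y => TangentSpace (𝓡 n) y) := by
  obtain ⟨g, hg, h⟩ := IsContMDiffRiemannianBundle.exists_contMDiff (IB := 𝓡 n) (n := ∞)
    (F := EuclideanSpace ℝ (Fin n)) (E := fun y : Y => TangentSpace (𝓡 n) y)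
  exact ⟨g, hg.continuous, h⟩

/-- A smooth form evaluated on continuous vector fields along a map is continuous. -/
theorem SmoothForm.continuousAt_apply {m k : ℕ} {M : Type*} [TopologicalSpace M]
    [ChartedSpace (EuclideanSpace ℝ (Fin m)) M] [IsManifold (𝓡 m) ∞ M]
    {F : Type*} [NormedAddCommGroup F] [NormedSpace ℝ F] {β : MForm m M F k} (hβ : SmoothForm β)
    {X : Type*} [TopologicalSpace X] {b : X → M} {x : X}
    (hb : ContinuousAt b x) {v : Fin k → ∀ x, TangentSpace (𝓡 m) (b x)}
    (hv : ∀ i, ContinuousAt (fun x => (⟨b x, v i x⟩ : TangentBundle (𝓡 m) M)) x) :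
    ContinuousAt (fun x => β (b x) (fun i => v i x)) x := by
  let ψ := extChartAt (𝓡 m) (b x)
  let e := trivializationAt (EuclideanSpace ℝ (Fin m)) (TangentSpace (𝓡 m)) (b x)
  have h1 : ContinuousAt (fun z => chartForm β (b x) (ψ (b z))) x := by
    have h2 : ContinuousAt (chartForm β (b x)) (ψ (b x)) :=
      (hβ (b x)).continuousOn.continuousAt (extChartAt_target_mem_nhds _)
    exact ContinuousAt.comp (g := chartForm β (b x)) h2
      ((continuousAt_extChartAt (I := 𝓡 m) (b x)).comp hb)
  have h3 : ContinuousAt (fun z => fun i => e.continuousLinearMapAt ℝ (b z) (v i z)) x := by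
    refine continuousAt_pi.2 fun i => ?_
    have h4 := ((FiberBundle.continuousAt_totalSpace (EuclideanSpace ℝ (Fin m)) _).1 (hv i)).2
    refine h4.congr ?_
    filter_upwards [hb (e.open_baseSet.mem_nhds (mem_baseSet_trivializationAt _ _ _))] with z hz
    exact (e.coe_linearMapAt_of_mem (R := ℝ) hz ▸ rfl)
  have h5 := h1.eval h3
  refine h5.congr ?_
  filter_upwards [hb ((isOpen_extChartAt_source (I := 𝓡 m) (b x)).mem_nhds
    (mem_extChartAt_source _))] with z hz
  have key : ∀ q : M, q = b z → ∀ w : Fin k → EuclideanSpace ℝ (Fin m), β q w = β (b z) w := by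
    rintro q rfl w
    rfl
  refine Eq.trans (key _ (ψ.left_inv hz) _) ?_
  congr 1
  funext i
  -- The trivialization applies the derivative of the chart and `chartForm` applies that of its
  -- inverse; together they restore `v i z`.
  have h6 := mfderivWithin_extChartAt_symm_comp_mfderiv_extChartAt' (I := 𝓡 m) hz
  rw [ModelWithCorners.range_eq_univ, mfderivWithin_univ] at h6
  have h7 := TangentBundle.continuousLinearMapAt_trivializationAt (I := 𝓡 m) (x₀ := b x)
    (x := b z) (by simpa using hz)
  have h8 := DFunLike.congr_fun h6 (v i z)
  refine Eq.trans ?_ h8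
  exact congrArg (fun w : EuclideanSpace ℝ (Fin m) =>
    (mfderiv (𝓡 m) (𝓡 m) ψ.symm (ψ (b z)) w : EuclideanSpace ℝ (Fin m)))
    (DFunLike.congr_fun h7 (v i z))

/-- The push-forward of a constant vector field in a chart, along a smooth map. -/
theorem continuousAt_mfderiv_extChartAt_symm {m n : ℕ} {M Y : Type*} [TopologicalSpace M]
    [ChartedSpace (EuclideanSpace ℝ (Fin m)) M] [IsManifold (𝓡 m) ∞ M] [TopologicalSpace Y]
    [ChartedSpace (EuclideanSpace ℝ (Fin n)) Y] [IsManifold (𝓡 n) ∞ Y] {pr : M → Y}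
    (hpr : ContMDiff (𝓡 m) (𝓡 n) ∞ pr) (x : M) (c : EuclideanSpace ℝ (Fin m)) :
    ContinuousAt (fun u => (⟨pr ((extChartAt (𝓡 m) x).symm u),
      mfderiv (𝓡 m) (𝓡 n) pr ((extChartAt (𝓡 m) x).symm u)
        (mfderiv (𝓡 m) (𝓡 m) (extChartAt (𝓡 m) x).symm u c)⟩ : TangentBundle (𝓡 n) Y))
      (extChartAt (𝓡 m) x x) := by
  have h1 : ContMDiffOn (𝓡 m) (𝓡 n) ∞ (pr ∘ (extChartAt (𝓡 m) x).symm)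
      (extChartAt (𝓡 m) x).target := hpr.comp_contMDiffOn (contMDiffOn_extChartAt_symm x)
  have ho := isOpen_extChartAt_target (I := 𝓡 m) x
  have h2 := h1.continuousOn_tangentMapWithin (by simp) ho.uniqueMDiffOn
  have h3 : Continuous (fun u : EuclideanSpace ℝ (Fin m) =>
      (⟨u, c⟩ : TangentBundle (𝓡 m) (EuclideanSpace ℝ (Fin m)))) :=
    (tangentBundleModelSpaceHomeomorph (𝓡 m)).symm.continuous.comp
      (continuous_id.prodMk continuous_const)
  have h4 : ContinuousAt (fun u : EuclideanSpace ℝ (Fin m) =>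
      tangentMapWithin (𝓡 m) (𝓡 n) (pr ∘ (extChartAt (𝓡 m) x).symm) (extChartAt (𝓡 m) x).target
        (⟨u, c⟩ : TangentBundle (𝓡 m) (EuclideanSpace ℝ (Fin m)))) (extChartAt (𝓡 m) x x) := by
    refine (h2.comp h3.continuousOn (s := (extChartAt (𝓡 m) x).target)
      fun u hu => hu).continuousAt (extChartAt_target_mem_nhds x)
  refine h4.congr ?_
  filter_upwards [extChartAt_target_mem_nhds (I := 𝓡 m) x] with u hu
  have hd : MDifferentiableAt (𝓡 m) (𝓡 m) (extChartAt (𝓡 m) x).symm u :=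
    ((contMDiffOn_extChartAt_symm x).contMDiffAt (ho.mem_nhds hu)).mdifferentiableAt
      (n := ∞) (by simp)
  have hd' : MDifferentiableAt (𝓡 m) (𝓡 n) pr ((extChartAt (𝓡 m) x).symm u) :=
    (hpr _).mdifferentiableAt (by simp)
  rw [tangentMapWithin_eq_tangentMap (ho.uniqueMDiffWithinAt hu) (hd'.comp u hd)]
  simp only [tangentMap]
  rw [mfderiv_comp u hd' hd]
  rfl

variable {d : ℕ}
  {Y : Type*} [TopologicalSpace Y] [ChartedSpace (EuclideanSpace ℝ (Fin 2)) Y]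
  [IsManifold (𝓡 2) ∞ Y]
  [RiemannianBundle (fun y : Y => TangentSpace (𝓡 2) y)]
  [IsContMDiffRiemannianBundle (𝓡 2) ∞ (EuclideanSpace ℝ (Fin 2))
      (fun y : Y => TangentSpace (𝓡 2) y)]
  {G : Type*} [TopologicalSpace G] [ChartedSpace (EuclideanSpace ℝ (Fin d)) G] [Group G]
  {P : Type*} [TopologicalSpace P] [ChartedSpace (EuclideanSpace ℝ (Fin (2 + d))) P]
  [IsManifold (𝓡 (2 + d)) ∞ P]
  [MulAction Gᵐᵒᵖ P] {pr : P → Y}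

/-- On a surface, the Hodge star of a continuous `1`-form is continuous. -/
theorem IsPrincipalBundle.continuousAt_adStar (hpr : IsPrincipalBundle 2 d G pr)
    {o : ∀ y : Y, Orientation ℝ (TangentSpace (𝓡 2) y) (Fin 2)} (ho : IsManifoldOrientation o)
    (h : 1 + 1 = 2) {α : AdForm 2 d G pr 1} {p : P}
    (hα : ContinuousAt (chartForm (pullbackForm pr α) p) (extChartAt (𝓡 (2 + d)) p p)) :
    ContinuousAt (chartForm (pullbackForm pr (adStar pr o h α)) p)
      (extChartAt (𝓡 (2 + d)) p p) := by
  have : IsContinuousRiemannianBundle (EuclideanSpace ℝ (Fin 2))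
      (fun y : Y => TangentSpace (𝓡 2) y) := isContinuousRiemannianBundle_tangent
  let q : EuclideanSpace ℝ (Fin (2 + d)) → P := (extChartAt (𝓡 (2 + d)) p).symm
  -- The constant field `c` in the chart of P, pushed down to Y: these are the vectors on which the
  -- chart expression of a pulled-back form evaluates `α`.
  let L : EuclideanSpace ℝ (Fin (2 + d)) → ∀ u : EuclideanSpace ℝ (Fin (2 + d)),
      TangentSpace (𝓡 2) (pr (q u)) := fun c u =>
    mfderiv (𝓡 (2 + d)) (𝓡 2) pr (q u) (mfderiv (𝓡 (2 + d)) (𝓡 (2 + d)) q u c)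
  have hL : ∀ c, ContinuousAt (fun u => (⟨pr (q u), L c u⟩ : TangentBundle (𝓡 2) Y))
      (extChartAt (𝓡 (2 + d)) p p) := fun c =>
    continuousAt_mfderiv_extChartAt_symm hpr.contMDiff_proj p c
  have hq : ContinuousAt (fun u => pr (q u)) (extChartAt (𝓡 (2 + d)) p p) :=
    ((FiberBundle.continuousAt_totalSpace (EuclideanSpace ℝ (Fin 2)) _).1 (hL 0)).1
  have hinner : ∀ a b, ContinuousAt (fun u => inner ℝ (L a u) (L b u))
      (extChartAt (𝓡 (2 + d)) p p) := fun a b =>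
    ContinuousAt.inner_bundle (F := EuclideanSpace ℝ (Fin 2))
      (E := fun y : Y => TangentSpace (𝓡 2) y) (hL a) (hL b)
  have hvol : ∀ a b, ContinuousAt (fun u => volForm (o (pr (q u))) ![L a u, L b u])
      (extChartAt (𝓡 (2 + d)) p p) := by
    intro a b
    have h1 := SmoothForm.continuousAt_apply ho hq
      (v := ![L a, L b]) (fun i => by fin_cases i; exacts [hL a, hL b])
    refine h1.congr (Eventually.of_forall fun u => ?_)
    dsimp only
    congr 1
    funext i
    fin_cases i <;> rfl
  have hα1 : ∀ c, ContinuousAt (fun u => α (q u) ![L c u]) (extChartAt (𝓡 (2 + d)) p p) := by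
    intro c
    have h1 : ContinuousAt (fun u => chartForm (pullbackForm pr α) p u ![c])
        (extChartAt (𝓡 (2 + d)) p p) := hα.eval continuousAt_const
    refine h1.congr (Eventually.of_forall fun u => ?_)
    change α (q u) _ = _
    congr 1
    funext i
    fin_cases i
    rfl
  have hsurj : ∀ (z : P), z = p → ∀ w : TangentSpace (𝓡 2) (pr z), ∃ c,
      mfderiv (𝓡 (2 + d)) (𝓡 2) pr z c = w :=
    fun z _ w => hpr.surjective_mfderiv z w
  have hq0 : q (extChartAt (𝓡 (2 + d)) p p) = p := extChartAt_to_inv (I := 𝓡 (2 + d)) p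
  have hLs : ∀ w : TangentSpace (𝓡 2) (pr (q (extChartAt (𝓡 (2 + d)) p p))), ∃ c,
      L c (extChartAt (𝓡 (2 + d)) p p) = w := by
    intro w
    obtain ⟨c, hc⟩ := hsurj _ hq0 w
    refine ⟨c, Eq.trans ?_ hc⟩
    exact congrArg (mfderiv (𝓡 (2 + d)) (𝓡 2) pr (q (extChartAt (𝓡 (2 + d)) p p)))
      (mfderiv_extChartAt_symm_self p c)
  -- At the centre, `L a` and `L b` form an orthonormal frame. Nearby they need only stay
  -- independent, which the nonvanishing of the continuous function vol(L a, L b) ensures.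
  obtain ⟨a, ha⟩ := hLs (planarBasis _ 0)
  obtain ⟨b, hb⟩ := hLs (planarBasis _ 1)
  have hne : volForm (o (pr (q (extChartAt (𝓡 (2 + d)) p p))))
      ![L a (extChartAt (𝓡 (2 + d)) p p), L b (extChartAt (𝓡 (2 + d)) p p)] ≠ 0 := by
    rw [ha, hb]
    exact left_ne_zero_of_mul_eq_one (volForm_planarBasis_sq _)
  refine continuousAt_alternating fun w => ?_
  -- The right side of `volForm_smul_hodgeStar` divided by the volume: no pointwise choice of basis
  -- is left in it.
  have hmain : ContinuousAt (fun u => (volForm (o (pr (q u))) ![L a u, L b u])⁻¹ •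
      ((inner ℝ (L (w 0) u) (L b u) : ℝ) • α (q u) ![L a u] -
        (inner ℝ (L (w 0) u) (L a u) : ℝ) • α (q u) ![L b u])) (extChartAt (𝓡 (2 + d)) p p) :=
    ((hvol a b).inv₀ hne).smul (((hinner _ _).smul (hα1 a)).sub ((hinner _ _).smul (hα1 b)))
  refine hmain.congr ?_
  filter_upwards [(hvol a b).eventually_ne hne] with u hu
  rw [← volForm_smul_hodgeStar (o (pr (q u))) h, smul_smul, inv_mul_cancel₀ hu, one_smul]
  change _ = hodgeStar (o (pr (q u))) h (α (q u)) _
  congr 1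
  funext i
  fin_cases i
  rfl

end ContinuityOfHodgeStar

/-! ### The first order part of the operator -/

section Symbol

section ZerothOrder

variable {V : Type*} [NormedAddCommGroup V] [InnerProductSpace ℝ V] [FiniteDimensional ℝ V]
  {W : Type*} [NormedAddCommGroup W] [NormedSpace ℝ W] {n k l : ℕ} [Fact (finrank ℝ V = n)]

theorem hodgeStar_smul (o : Orientation ℝ V (Fin n)) (h : k + l = n) (c : ℝ)
    (α : V [⋀^Fin k]→L[ℝ] W) : hodgeStar o h (c • α) = c • hodgeStar o h α := by
  ext w
  simp [hodgeStar, Finset.smul_sum, smul_comm c]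

theorem hodgeStar_zero (o : Orientation ℝ V (Fin n)) (h : k + l = n) :
    hodgeStar o h (0 : V [⋀^Fin k]→L[ℝ] W) = 0 := by
  simpa using hodgeStar_smul o h 0 (0 : V [⋀^Fin k]→L[ℝ] W)

theorem wedgeBracket_zero_right {d : ℕ} {G : Type*} [TopologicalSpace G]
    [ChartedSpace (EuclideanSpace ℝ (Fin d)) G] [Group G] [LieGroup (𝓡 d) ∞ G]
    {V : Type*} [AddCommGroup V] [Module ℝ V] [TopologicalSpace V] {k l m : ℕ}
    (h : k + l = m) (a : V [⋀^Fin k]→L[ℝ] GroupLieAlgebra (𝓡 d) G) :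
    wedgeBracket h a (0 : V [⋀^Fin l]→L[ℝ] GroupLieAlgebra (𝓡 d) G) = 0 := by
  have : bracketMul a (0 : V [⋀^Fin l]→L[ℝ] GroupLieAlgebra (𝓡 d) G) = 0 := by
    ext v
    exact lie_zero (a fun i => v (Fin.castAdd l i))
  ext v
  simp [wedgeBracket, this, ContinuousMultilinearMap.alternatization_apply_apply]

end ZerothOrder

variable {n d : ℕ}
  {Y : Type*} [TopologicalSpace Y] [ChartedSpace (EuclideanSpace ℝ (Fin n)) Y]
  {G : Type*} [TopologicalSpace G] [ChartedSpace (EuclideanSpace ℝ (Fin d)) G] [Group G]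
  [LieGroup (𝓡 d) ∞ G]
  {P : Type*} [TopologicalSpace P] [ChartedSpace (EuclideanSpace ℝ (Fin (n + d))) P]
  [IsManifold (𝓡 (n + d)) ∞ P]
  [MulAction Gᵐᵒᵖ P] {pr : P → Y}

theorem IsPrincipalBundle.nablaS_smul_of_eq_zero (hpr : IsPrincipalBundle n d G pr)
    {A : ∀ p : P, TangentSpace (𝓡 (n + d)) p →L[ℝ] GroupLieAlgebra (𝓡 d) G}
    (hA : IsConnectionForm A) {I : Set ℝ} (hI : IsOpen I) {s : ℝ} (hs : s ∈ I) {p : P}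
    {f : ℝ × Y → ℝ} {τ : ℝ} (hf : HasDerivAt (fun t => f (t, pr p)) τ s) (h0 : f (s, pr p) = 0)
    (Ψ : ℝ → AdForm n d G pr 0) {k : ℕ} {α : ℝ → AdForm n d G pr k}
    (hα : IsSmoothAdPath pr I α) :
    nablaS pr Ψ (fun t q => f (t, pr q) • α t q) s p = τ • α s p := by
  have h1 : deriv (fun t => f (t, pr p) • α t p) s = τ • α s p :=
    deriv_smul_of_eq_zero (W := EuclideanSpace ℝ (Fin n) [⋀^Fin k]→L[ℝ] GroupLieAlgebra (𝓡 d) G)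
      hf h0 (hpr.continuousAt_time hA hI hα hs p)
  simp only [nablaS, h1, h0, zero_smul, wedgeBracket_zero_right, add_zero]

variable [RiemannianBundle (fun y : Y => TangentSpace (𝓡 n) y)]

/-- The operator applied to `f u` at a zero of `f`: only the terms of order one contribute. -/
theorem IsPrincipalBundle.linearizedOperator_smul_of_eq_zero (hpr : IsPrincipalBundle n d G pr)
    (hn : 2 ≤ n) (o : ∀ y : Y, Orientation ℝ (TangentSpace (𝓡 n) y) (Fin n))
    (A : ℝ → ∀ p : P, TangentSpace (𝓡 (n + d)) p →L[ℝ] GroupLieAlgebra (𝓡 d) G)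
    (om : ℝ → AdForm n d G pr (n - 2)) (Ψ : ℝ → AdForm n d G pr 0)
    {I : Set ℝ} (hI : IsOpen I) {s : ℝ} (hs : s ∈ I) (hA : IsConnectionForm (A s)) {p : P}
    {f : ℝ × Y → ℝ} {τ : ℝ} (hf : HasDerivAt (fun t => f (t, pr p)) τ s) (h0 : f (s, pr p) = 0)
    {u : TripleField n d G pr} (hu : IsSmoothTriple pr I u) :
    linearizedOperator hn pr o A om Ψ (fun t q => f (t, pr q) • u t q) s p =
      (τ • (u s p).1
          + (-1 : ℝ) ^ (n + 1) • adStar pr o (show n - 2 + 1 + 1 = n by omega)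
            (covExtDeriv pr (A s) (fun q => f (s, pr q) • (u s q).2.1)) p
          - covExtDeriv pr (A s) (fun q => f (s, pr q) • (u s q).2.2) p,
        τ • (u s p).2.1
          + adStar pr o (show 1 + 1 + (n - 2) = n by omega)
            (covExtDeriv pr (A s) (fun q => f (s, pr q) • (u s q).1)) p,
        τ • (u s p).2.2
          + adStar pr o (show n - 1 + 1 + 0 = n by omega) (covExtDeriv pr (A s)
            (fun q => f (s, pr q) • adStar pr o (show 1 + (n - 1) = n by omega)
              (fun q => (u s q).1) q)) p) := by
  have h1 := hpr.nablaS_smul_of_eq_zero hA hI hs hf h0 Ψ hu.fst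
  have h2 := hpr.nablaS_smul_of_eq_zero hA hI hs hf h0 Ψ hu.snd
  have h3 := hpr.nablaS_smul_of_eq_zero hA hI hs hf h0 Ψ hu.thd
  -- The star is linear over functions, so `f` passes through it and `d_A` acts on `f` times ⋆α.
  have h4 : adStar pr o (show 1 + (n - 1) = n by omega) (fun q => f (s, pr q) • (u s q).1) =
      fun q => f (s, pr q) • adStar pr o (show 1 + (n - 1) = n by omega)
        (fun q => (u s q).1) q := by
    funext q
    exact hodgeStar_smul _ _ _ _
  simp only [linearizedOperator, covCoderiv, Prod.smul_fst, Prod.smul_snd, h1, h2, h3, h4, h0,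
    zero_smul, wedgeBracket_zero_right, hodgeStar_zero, add_zero, sub_zero, Pi.neg_apply,
    sub_neg_eq_add]

end Symbol

/-! ### The symbol matrix on a surface -/

section PlanarSymbol

variable {W : Type*} [AddCommGroup W] [Module ℝ W]

/-- The symbol for `n = 2` in an orthonormal frame: `τ, x, y` are the components of the covector
and `ε = ±1` is the orientation of the frame. -/
def planarSymbol (ε τ x y : ℝ) : W × W × W × W →ₗ[ℝ] W × W × W × W where
  toFun z := (τ • z.1 + (ε * y) • z.2.2.1 - x • z.2.2.2,
    τ • z.2.1 - (ε * x) • z.2.2.1 - y • z.2.2.2,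
    τ • z.2.2.1 + ε • (x • z.2.1 - y • z.1),
    τ • z.2.2.2 + (x • z.1 + y • z.2.1))
  map_add' := by
    intro z w
    simp only [Prod.fst_add, Prod.snd_add, Prod.mk_add_mk]
    refine Prod.ext ?_ (Prod.ext ?_ (Prod.ext ?_ ?_)) <;> dsimp only <;> module
  map_smul' := by
    intro c z
    simp only [Prod.smul_fst, Prod.smul_snd, RingHom.id_apply, Prod.smul_mk]
    refine Prod.ext ?_ (Prod.ext ?_ (Prod.ext ?_ ?_)) <;> dsimp only <;> module

/-- The part without `τ` is a skew matrix S, odd in (x, y), with S² = -(x² + y²); reversing (x, y)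
gives the conjugate factor τ - S. -/
theorem planarSymbol_planarSymbol {ε : ℝ} (hε : ε * ε = 1) (τ x y : ℝ) (z : W × W × W × W) :
    planarSymbol ε τ (-x) (-y) (planarSymbol ε τ x y z) = (τ ^ 2 + x ^ 2 + y ^ 2) • z := by
  obtain ⟨a, b, v, w⟩ := z
  refine Prod.ext ?_ (Prod.ext ?_ (Prod.ext ?_ ?_)) <;>
    simp only [planarSymbol, LinearMap.coe_mk, AddHom.coe_mk, Prod.smul_mk] <;>
    -- Each matrix entry is a polynomial identity modulo ε² = 1; the multiplier depends on the
    -- entry, for instance y² for the first diagonal one.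
    match_scalars <;> first | ring1 | linear_combination (y ^ 2) * hε |
      linear_combination (x ^ 2) * hε | linear_combination (x ^ 2 + y ^ 2) * hε |
      linear_combination (x * y) * hε | linear_combination (-x * y) * hε

/-- The symbol at a nonzero covector is invertible. -/
def planarSymbolEquiv {ε : ℝ} (hε : ε * ε = 1) {τ x y : ℝ} (h : τ ^ 2 + x ^ 2 + y ^ 2 ≠ 0) :
    (W × W × W × W) ≃ₗ[ℝ] W × W × W × W :=
  { planarSymbol (W := W) ε τ x y with
    invFun := fun z => (τ ^ 2 + x ^ 2 + y ^ 2)⁻¹ • planarSymbol ε τ (-x) (-y) z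
    left_inv := fun z => by
      change (τ ^ 2 + x ^ 2 + y ^ 2)⁻¹ • planarSymbol ε τ (-x) (-y) (planarSymbol ε τ x y z) = z
      rw [planarSymbol_planarSymbol hε, inv_smul_smul₀ h]
    right_inv := fun z => by
      change planarSymbol ε τ x y ((τ ^ 2 + x ^ 2 + y ^ 2)⁻¹ • planarSymbol ε τ (-x) (-y) z) = z
      have := planarSymbol_planarSymbol hε τ (-x) (-y) z
      rw [neg_neg, neg_neg, neg_sq, neg_sq] at this
      rw [map_smul, this, inv_smul_smul₀ h] }

/-- The components of a triple of forms of degrees `1, 0, 0` in an orthonormal frame. -/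
def planarCoordinates (V W : Type*) [NormedAddCommGroup V] [InnerProductSpace ℝ V]
    [FiniteDimensional ℝ V] [Fact (finrank ℝ V = 2)] [NormedAddCommGroup W] [NormedSpace ℝ W] :
    ((V [⋀^Fin 1]→L[ℝ] W) × (V [⋀^Fin 0]→L[ℝ] W) × (V [⋀^Fin 0]→L[ℝ] W)) ≃ₗ[ℝ]
      W × W × W × W where
  toFun u := (u.1 ![planarBasis V 0], u.1 ![planarBasis V 1], u.2.1 ![], u.2.2 ![])
  map_add' _ _ := rfl
  map_smul' _ _ := rfl
  invFun z := (ContinuousAlternatingMap.ofSubsingleton ℝ V W (0 : Fin 1)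
      ((innerSL ℝ (planarBasis V 0)).smulRight z.1 + (innerSL ℝ (planarBasis V 1)).smulRight z.2.1),
    ContinuousAlternatingMap.constOfIsEmpty ℝ V (Fin 0) z.2.2.1,
    ContinuousAlternatingMap.constOfIsEmpty ℝ V (Fin 0) z.2.2.2)
  left_inv u := by
    refine Prod.ext ?_ (Prod.ext ?_ ?_)
    · ext w
      let L := (ContinuousAlternatingMap.ofSubsingleton ℝ V W (0 : Fin 1)).symm u.1
      have hL : ∀ z, u.1 z = L (z 0) := by
        intro z
        change _ = u.1 _
        congr 1
        funext i
        fin_cases i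
        rfl
      change inner ℝ (planarBasis V 0) (w 0) • u.1 ![planarBasis V 0] +
        inner ℝ (planarBasis V 1) (w 0) • u.1 ![planarBasis V 1] = u.1 w
      rw [hL, hL, hL]
      conv_rhs => rw [← (planarBasis V).sum_repr' (w 0)]
      simp [Fin.sum_univ_two]
    · ext w
      exact congrArg u.2.1 (Subsingleton.elim _ _)
    · ext w
      exact congrArg u.2.2 (Subsingleton.elim _ _)
  right_inv z := by
    have h := orthonormal_iff_ite.1 (planarBasis V).orthonormal
    refine Prod.ext ?_ (Prod.ext ?_ (Prod.ext rfl rfl))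
    · change inner ℝ (planarBasis V 0) (planarBasis V 0) • z.1 +
        inner ℝ (planarBasis V 1) (planarBasis V 0) • z.2.1 = z.1
      simp [h]
    · change inner ℝ (planarBasis V 0) (planarBasis V 1) • z.1 +
        inner ℝ (planarBasis V 1) (planarBasis V 1) • z.2.1 = z.2.1
      simp [h]

end PlanarSymbol

/-! ### Ellipticity in dimension two -/

section Surfaces

theorem eq_zero_of_sq_add_sq_add_sq_eq_zero {a b c : ℝ} (h : a ^ 2 + b ^ 2 + c ^ 2 = 0) :
    a = 0 ∧ b = 0 ∧ c = 0 := by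
  refine ⟨?_, ?_, ?_⟩ <;> nlinarith [sq_nonneg a, sq_nonneg b, sq_nonneg c]

variable {d : ℕ}
  {Y : Type*} [TopologicalSpace Y] [ChartedSpace (EuclideanSpace ℝ (Fin 2)) Y]
  {G : Type*} [TopologicalSpace G] [ChartedSpace (EuclideanSpace ℝ (Fin d)) G] [Group G]
  [LieGroup (𝓡 d) ∞ G]
  {P : Type*} [TopologicalSpace P] [ChartedSpace (EuclideanSpace ℝ (Fin (2 + d))) P]
  [IsManifold (𝓡 (2 + d)) ∞ P]
  [MulAction Gᵐᵒᵖ P] {pr : P → Y}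

theorem IsPrincipalBundle.covExtDeriv_smul_zero_form (hpr : IsPrincipalBundle 2 d G pr)
    {A : ∀ p : P, TangentSpace (𝓡 (2 + d)) p →L[ℝ] GroupLieAlgebra (𝓡 d) G}
    (hA : IsConnectionForm A) {α : AdForm 2 d G pr 0} {p : P} {f : Y → ℝ}
    (hf : MDifferentiableAt (𝓡 2) 𝓘(ℝ, ℝ) f (pr p)) (hp : f (pr p) = 0)
    (hα : ContinuousAt (chartForm (pullbackForm pr α) p) (extChartAt (𝓡 (2 + d)) p p))
    (w : TangentSpace (𝓡 2) (pr p)) :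
    covExtDeriv pr A (fun q => f (pr q) • α q) p ![w] =
      differential f (pr p) w • α p ![] := by
  rw [hpr.covExtDeriv_smul_of_eq_zero hA hf hp hα]
  rw [Fin.sum_univ_one]
  simp only [Fin.val_zero, pow_zero, one_smul, Matrix.cons_val_zero]
  congr 2

theorem IsPrincipalBundle.covExtDeriv_smul_one_form (hpr : IsPrincipalBundle 2 d G pr)
    {A : ∀ p : P, TangentSpace (𝓡 (2 + d)) p →L[ℝ] GroupLieAlgebra (𝓡 d) G}
    (hA : IsConnectionForm A) {α : AdForm 2 d G pr 1} {p : P} {f : Y → ℝ}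
    (hf : MDifferentiableAt (𝓡 2) 𝓘(ℝ, ℝ) f (pr p)) (hp : f (pr p) = 0)
    (hα : ContinuousAt (chartForm (pullbackForm pr α) p) (extChartAt (𝓡 (2 + d)) p p))
    (v w : TangentSpace (𝓡 2) (pr p)) :
    covExtDeriv pr A (fun q => f (pr q) • α q) p ![v, w] =
      differential f (pr p) v • α p ![w] - differential f (pr p) w • α p ![v] := by
  rw [hpr.covExtDeriv_smul_of_eq_zero hA hf hp hα]
  rw [Fin.sum_univ_two]
  have h0 : (0 : Fin 2).removeNth ![v, w] = ![w] := by
    funext i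
    fin_cases i
    rfl
  have h1 : (1 : Fin 2).removeNth ![v, w] = ![v] := by
    funext i
    fin_cases i
    rfl
  rw [h0, h1, sub_eq_add_neg]
  simp

variable [IsManifold (𝓡 2) ∞ Y]
  [RiemannianBundle (fun y : Y => TangentSpace (𝓡 2) y)]
  [IsContMDiffRiemannianBundle (𝓡 2) ∞ (EuclideanSpace ℝ (Fin 2))
      (fun y : Y => TangentSpace (𝓡 2) y)]

omit [IsManifold (𝓡 2) ∞ Y] [IsContMDiffRiemannianBundle (𝓡 2) ∞ (EuclideanSpace ℝ (Fin 2))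
      (fun y : Y => TangentSpace (𝓡 2) y)] in
-- The differential is the sum of its time and slice partials, and the slice partial is zero once it
-- vanishes on an orthonormal frame.
theorem covector_components_ne_zero {f : ℝ × Y → ℝ} {s : ℝ} {y : Y}
    (hf : MDifferentiableAt ((𝓘(ℝ, ℝ)).prod (𝓡 2)) 𝓘(ℝ, ℝ) f (s, y)) {τ : ℝ}
    (hτ : HasDerivAt (fun t => f (t, y)) τ s)
    (hne : mfderiv ((𝓘(ℝ, ℝ)).prod (𝓡 2)) 𝓘(ℝ, ℝ) f (s, y) ≠ 0) :
    τ ^ 2 + differential (fun z => f (s, z)) y (planarBasis (TangentSpace (𝓡 2) y) 0) ^ 2 +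
      differential (fun z => f (s, z)) y (planarBasis (TangentSpace (𝓡 2) y) 1) ^ 2 ≠ 0 := by
  intro h
  refine hne ?_
  obtain ⟨hτ0, h0, h1⟩ := eq_zero_of_sq_add_sq_add_sq_eq_zero h
  have hξ : ∀ w : TangentSpace (𝓡 2) y, differential (fun z => f (s, z)) y w = 0 := by
    intro w
    rw [← (planarBasis (TangentSpace (𝓡 2) y)).sum_repr' w]
    simp [Fin.sum_univ_two, h0, h1]
  have htime : ∀ a : ℝ, mfderiv 𝓘(ℝ, ℝ) 𝓘(ℝ, ℝ) (fun t => f (t, y)) s a = (0 : ℝ) := by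
    intro a
    rw [mfderiv_eq_fderiv, hτ.hasFDerivAt.fderiv, hτ0]
    exact mul_zero a
  refine ContinuousLinearMap.ext fun v => ?_
  refine (mfderiv_prod_eq_add_apply hf).trans ?_
  refine Eq.trans (congrArg₂ (fun a b : ℝ => a + b) (htime v.1) (hξ v.2)) ?_
  exact add_zero 0

/-- On a surface the operator is elliptic. -/
theorem isElliptic_linearizedOperator_surface (hpr : IsPrincipalBundle 2 d G pr)
    (o : ∀ y : Y, Orientation ℝ (TangentSpace (𝓡 2) y) (Fin 2)) (ho : IsManifoldOrientation o)
    {I : Set ℝ} (hI : IsOpen I)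
    {A : ℝ → ∀ p : P, TangentSpace (𝓡 (2 + d)) p →L[ℝ] GroupLieAlgebra (𝓡 d) G}
    (hA : IsSmoothConnectionPath I A)
    (om : ℝ → AdForm 2 d G pr (2 - 2)) (Ψ : ℝ → AdForm 2 d G pr 0) :
    IsElliptic pr I (linearizedOperator le_rfl pr o A om Ψ) := by
  intro s hs p f hf h0 hne
  have hfd : MDifferentiableAt ((𝓘(ℝ, ℝ)).prod (𝓡 2)) 𝓘(ℝ, ℝ) f (s, pr p) :=
    (hf _).mdifferentiableAt (by simp)
  have hτ : HasDerivAt (fun t => f (t, pr p)) (deriv (fun t => f (t, pr p)) s) s := by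
    have h1 : MDifferentiableAt 𝓘(ℝ, ℝ) 𝓘(ℝ, ℝ) (fun t => f (t, pr p)) s :=
      hfd.comp s (mdifferentiableAt_id.prodMk mdifferentiableAt_const)
    exact h1.differentiableAt.hasDerivAt
  have hfs : MDifferentiableAt (𝓡 2) 𝓘(ℝ, ℝ) (fun z => f (s, z)) (pr p) :=
    hfd.comp (pr p) (mdifferentiableAt_const.prodMk mdifferentiableAt_id)
  set τ := deriv (fun t => f (t, pr p)) s with hτdef
  have hnz := covector_components_ne_zero hfd hτ hne
  let V := TangentSpace (𝓡 2) (pr p)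
  let b := planarBasis V
  have hε := volForm_planarBasis_sq (o (pr p))
  let E := planarCoordinates V (GroupLieAlgebra (𝓡 d) G)
  refine ⟨(E.trans (planarSymbolEquiv hε hnz)).trans E.symm, fun u hu => ?_⟩
  have hA' := hA.isConnection s hs
  -- The comparison takes place in frame coordinates, one component at a time.
  refine E.injective ?_
  refine Eq.trans ?_ (E.apply_symm_apply _).symm
  rw [hpr.linearizedOperator_smul_of_eq_zero le_rfl o A om Ψ hI hs hA' hτ h0 hu]
  have hc1 := hu.fst.smooth.continuousAt_space hI hs p
  have hc2 := hu.snd.smooth.continuousAt_space hI hs p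
  have hc3 := hu.thd.smooth.continuousAt_space hI hs p
  have hstar : ∀ (β : V [⋀^Fin 1]→L[ℝ] GroupLieAlgebra (𝓡 d) G),
      hodgeStar (o (pr p)) (rfl : 1 + 1 = 2) β ![b 0] =
        -(volForm (o (pr p)) ![b 0, b 1] • β ![b 1]) ∧
      hodgeStar (o (pr p)) (rfl : 1 + 1 = 2) β ![b 1] =
        volForm (o (pr p)) ![b 0, b 1] • β ![b 0] := by
    intro β
    have hz : ∀ x : V, volForm (o (pr p)) ![x, x] = 0 := fun x =>
      (volForm (o (pr p))).map_eq_zero_of_eq ![x, x] (i := 0) (j := 1) rfl (by decide)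
    rw [hodgeStar_one_apply, hodgeStar_one_apply, hz, hz,
      alternating_swap (volForm (o (pr p))) (planarBasis V 0) (b 1)]
    rw [zero_smul, zero_smul, zero_add, add_zero, neg_smul]
    exact ⟨rfl, rfl⟩
  have hdv : ∀ w : V, covExtDeriv pr (A s) (fun q => f (s, pr q) • (u s q).2.1) p ![w] =
      differential (fun z => f (s, z)) (pr p) w • (u s p).2.1 ![] := fun w =>
    hpr.covExtDeriv_smul_zero_form hA' (f := fun z => f (s, z)) hfs h0 hc2 w
  have hdψ : ∀ w : V, covExtDeriv pr (A s) (fun q => f (s, pr q) • (u s q).2.2) p ![w] =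
      differential (fun z => f (s, z)) (pr p) w • (u s p).2.2 ![] := fun w =>
    hpr.covExtDeriv_smul_zero_form hA' (f := fun z => f (s, z)) hfs h0 hc3 w
  have hdα := hpr.covExtDeriv_smul_one_form hA' (f := fun z => f (s, z)) hfs h0 hc1 (b 0) (b 1)
  -- This is where the continuity of ⋆α enters, for the term ⋆d_A⋆α.
  have hdα' := hpr.covExtDeriv_smul_one_form hA' (f := fun z => f (s, z)) hfs h0
    (hpr.continuousAt_adStar ho rfl hc1) (b 0) (b 1)
  have hα1 : ∀ i : Fin 2,
      (τ • (u s p).1 + (-1 : ℝ) ^ (2 + 1) • hodgeStar (o (pr p)) (rfl : 1 + 1 = 2)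
          (covExtDeriv pr (A s) (fun q => f (s, pr q) • (u s q).2.1) p) -
        covExtDeriv pr (A s) (fun q => f (s, pr q) • (u s q).2.2) p) ![b i] =
      τ • (u s p).1 ![b i] - hodgeStar (o (pr p)) (rfl : 1 + 1 = 2)
          (covExtDeriv pr (A s) (fun q => f (s, pr q) • (u s q).2.1) p) ![b i] -
        differential (fun z => f (s, z)) (pr p) (b i) • (u s p).2.2 ![] := by
    intro i
    rw [← hdψ]
    have : (-1 : ℝ) ^ (2 + 1) = -1 := by norm_num
    rw [this, neg_one_smul, ← sub_eq_add_neg]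
    rfl
  refine Prod.ext ?_ (Prod.ext ?_ (Prod.ext ?_ ?_))
  · refine (hα1 0).trans ?_
    rw [(hstar _).1, hdv]
    change _ = τ • (u s p).1 ![b 0] + (volForm (o (pr p)) ![b 0, b 1] *
      differential (fun z => f (s, z)) (pr p) (b 1)) • (u s p).2.1 ![] -
      differential (fun z => f (s, z)) (pr p) (b 0) • (u s p).2.2 ![]
    rw [smul_smul, sub_neg_eq_add]
  · refine (hα1 1).trans ?_
    rw [(hstar _).2, hdv]
    change _ = τ • (u s p).1 ![b 1] - (volForm (o (pr p)) ![b 0, b 1] *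
      differential (fun z => f (s, z)) (pr p) (b 0)) • (u s p).2.1 ![] -
      differential (fun z => f (s, z)) (pr p) (b 1) • (u s p).2.2 ![]
    rw [smul_smul]
  · change τ • (u s p).2.1 ![] + hodgeStar (o (pr p)) (rfl : 1 + 1 + 0 = 2)
      (covExtDeriv pr (A s) (fun q => f (s, pr q) • (u s q).1) p) ![] =
      τ • (u s p).2.1 ![] + volForm (o (pr p)) ![b 0, b 1] •
        (differential (fun z => f (s, z)) (pr p) (b 0) • (u s p).1 ![b 1] -
          differential (fun z => f (s, z)) (pr p) (b 1) • (u s p).1 ![b 0])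
    rw [hodgeStar_two_apply]
    exact congrArg (fun z => τ • (u s p).2.1 ![] + volForm (o (pr p)) ![b 0, b 1] • z) hdα
  · change τ • (u s p).2.2 ![] + hodgeStar (o (pr p)) (rfl : 1 + 1 + 0 = 2)
      (covExtDeriv pr (A s) (fun q => f (s, pr q) • adStar pr o (rfl : 1 + 1 = 2)
        (fun q => (u s q).1) q) p) ![] =
      τ • (u s p).2.2 ![] +
        (differential (fun z => f (s, z)) (pr p) (b 0) • (u s p).1 ![b 0] +
          differential (fun z => f (s, z)) (pr p) (b 1) • (u s p).1 ![b 1])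
    rw [hodgeStar_two_apply]
    refine congrArg (fun z => τ • (u s p).2.2 ![] + z) ?_
    refine (congrArg (fun z => volForm (o (pr p)) ![b 0, b 1] • z) hdα').trans ?_
    have h1 := hstar (u s p).1
    simp only [adStar]
    rw [h1.1, h1.2, smul_neg, sub_neg_eq_add, smul_add, smul_smul, smul_smul, smul_smul,
      smul_smul]
    -- Each of the two stars contributes a factor ε, so the gauge-fixing row does not depend on the
    -- orientation of the frame.
    have hr : ∀ c : ℝ, volForm (o (pr p)) ![b 0, b 1] * c * volForm (o (pr p)) ![b 0, b 1] = c :=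
      fun c => by rw [mul_right_comm]; exact (congrArg (· * c) hε).trans (one_mul c)
    rw [hr, hr]

end Surfaces

/-! ### Multiplicativity and smoothness of the adjoint representation -/

section AdjointRepresentation

variable {d : ℕ} {G : Type*} [TopologicalSpace G] [ChartedSpace (EuclideanSpace ℝ (Fin d)) G]
  [Group G]

theorem Ad_one (X : GroupLieAlgebra (𝓡 d) G) : Ad (1 : G) X = X := by
  have h : (fun x : G => 1 * x * 1⁻¹) = id := by
    funext x
    simp
  change mfderiv (𝓡 d) (𝓡 d) (fun x : G => 1 * x * 1⁻¹) 1 X = X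
  rw [h, mfderiv_id]
  rfl

variable [LieGroup (𝓡 d) ∞ G]

theorem mdifferentiableAt_conj (h x : G) :
    MDifferentiableAt (𝓡 d) (𝓡 d) (fun x : G => h * x * h⁻¹) x :=
  ((contMDiff_mul_right (I := 𝓡 d) (n := ∞) (a := h⁻¹)).comp
    (contMDiff_mul_left (I := 𝓡 d) (n := ∞) (a := h))).mdifferentiableAt (by simp)

theorem Ad_mul (h k : G) (X : GroupLieAlgebra (𝓡 d) G) : Ad (h * k) X = Ad h (Ad k X) := by
  have hc : (fun x : G => (h * k) * x * (h * k)⁻¹) =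
      (fun x : G => h * x * h⁻¹) ∘ fun x : G => k * x * k⁻¹ := by
    funext x
    simp [mul_assoc]
  have hq : ∀ q : G, q = 1 → ∀ w : EuclideanSpace ℝ (Fin d),
      (mfderiv (𝓡 d) (𝓡 d) (fun x : G => h * x * h⁻¹) q w : EuclideanSpace ℝ (Fin d)) =
        mfderiv (𝓡 d) (𝓡 d) (fun x : G => h * x * h⁻¹) 1 w := by
    rintro q rfl w
    rfl
  change mfderiv (𝓡 d) (𝓡 d) (fun x : G => (h * k) * x * (h * k)⁻¹) 1 X = _
  rw [hc, mfderiv_comp (1 : G) (mdifferentiableAt_conj h _) (mdifferentiableAt_conj k 1)]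
  exact hq _ (by simp) _

/-- The vector `Ad g X` is the image of the tangent vector (0, X) at (g, 1) under the tangent map of
(g, x) ↦ g x g⁻¹, and tangent maps of smooth maps are smooth. -/
theorem contMDiff_Ad (X : GroupLieAlgebra (𝓡 d) G) :
    ContMDiff (𝓡 d) 𝓘(ℝ, GroupLieAlgebra (𝓡 d) G) ∞ (fun g : G => Ad g X) := by
  have hG : IsManifold (𝓡 d) ∞ G := ContMDiffMul.toIsManifold
  have hF : ContMDiff ((𝓡 d).prod (𝓡 d)) (𝓡 d) ∞ (fun q : G × G => q.1 * q.2 * q.1⁻¹) :=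
    ((contMDiff_mul (𝓡 d) ∞).comp (contMDiff_fst.prodMk contMDiff_snd)).mul
      ((contMDiff_inv (𝓡 d) ∞).comp contMDiff_fst)
  have hS : ContMDiff (𝓡 d) (𝓡 d).tangent ∞ (fun g : G =>
      tangentMap ((𝓡 d).prod (𝓡 d)) (𝓡 d) (fun q : G × G => q.1 * q.2 * q.1⁻¹)
        ((equivTangentBundleProd (𝓡 d) G (𝓡 d) G).symm
          ((⟨g, 0⟩ : TangentBundle (𝓡 d) G), (⟨1, X⟩ : TangentBundle (𝓡 d) G)))) := by
    refine (hF.contMDiff_tangentMap (m := ∞) (by simp)).comp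
      (contMDiff_equivTangentBundleProd_symm.comp ?_)
    exact (contMDiff_zeroSection ℝ (TangentSpace (𝓡 d))).prodMk contMDiff_const
  have hT : ∀ g : G, tangentMap ((𝓡 d).prod (𝓡 d)) (𝓡 d) (fun q : G × G => q.1 * q.2 * q.1⁻¹)
        ((equivTangentBundleProd (𝓡 d) G (𝓡 d) G).symm
          ((⟨g, 0⟩ : TangentBundle (𝓡 d) G), (⟨1, X⟩ : TangentBundle (𝓡 d) G))) =
      (⟨1, Ad g X⟩ : TangentBundle (𝓡 d) G) := by
    intro g
    have hb : ∀ q : G, q = 1 → ∀ w : EuclideanSpace ℝ (Fin d),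
        (⟨q, w⟩ : TangentBundle (𝓡 d) G) = ⟨1, w⟩ := by
      rintro q rfl w
      rfl
    refine Eq.trans (hb _ (by simp [equivTangentBundleProd]) _) ?_
    congr 1
    have h1 := mfderiv_prod_eq_add_apply (p := (g, (1 : G))) (v := ((0, X) :
      EuclideanSpace ℝ (Fin d) × EuclideanSpace ℝ (Fin d)))
      ((hF (g, 1)).mdifferentiableAt (by simp))
    refine h1.trans ?_
    refine (congrArg₂ (fun a b : EuclideanSpace ℝ (Fin d) => a + b)
      (map_zero (mfderiv (𝓡 d) (𝓡 d) (fun z : G => z * 1 * z⁻¹) g)) rfl).trans ?_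
    exact zero_add _
  simp only [hT] at hS
  intro g
  have h2 := (contMDiffAt_totalSpace.1 (hS g)).2
  refine h2.congr_of_eventuallyEq (Filter.Eventually.of_forall fun k => ?_)
  -- The curve of tangent vectors stays over 1, where the trivialization centred at 1 is the
  -- identity; its fibre component is `Ad k X` itself.
  have h3 := TangentBundle.continuousLinearMapAt_trivializationAt (I := 𝓡 d) (x₀ := (1 : G))
    (x := (1 : G)) (mem_chart_source _ _)
  rw [mfderiv_extChartAt_self] at h3
  have h4 := DFunLike.congr_fun h3 (Ad k X)
  refine Eq.trans h4.symm ?_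
  exact ((trivializationAt (EuclideanSpace ℝ (Fin d)) (TangentSpace (𝓡 d))
    (1 : G)).coe_linearMapAt_of_mem (R := ℝ) (mem_baseSet_trivializationAt _ _ _) ▸ rfl)

end AdjointRepresentation

/-! ### Global functions and sections with prescribed data at a point -/

section GlobalSections

open Filter Topology

/-- A centred chart cut off by a bump function that equals 1 near `y`. Its components supply both
the covector and the form used in higher dimensions. -/
theorem exists_contMDiff_mfderiv_eq_id {n : ℕ} {Y : Type*} [TopologicalSpace Y]
    [ChartedSpace (EuclideanSpace ℝ (Fin n)) Y] [IsManifold (𝓡 n) ∞ Y] [T2Space Y] (y : Y) :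
    ∃ H : Y → EuclideanSpace ℝ (Fin n), ContMDiff (𝓡 n) (𝓡 n) ∞ H ∧ H y = 0 ∧
      ∀ w : EuclideanSpace ℝ (Fin n),
        (mfderiv (𝓡 n) (𝓡 n) H y w : EuclideanSpace ℝ (Fin n)) = w := by
  let χ : SmoothBumpFunction (𝓡 n) y := Classical.arbitrary _
  let ψ := extChartAt (𝓡 n) y
  have h1 : ContMDiffOn (𝓡 n) (𝓡 n) ∞ (fun z => ψ z - ψ y) (chartAt _ y).source :=
    (contMDiffOn_extChartAt (I := 𝓡 n) (n := ∞) (x := y)).sub contMDiffOn_const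
  refine ⟨fun z => χ z • (ψ z - ψ y), χ.contMDiff_smul h1, by simp, fun w => ?_⟩
  have h2 : (fun z => χ z • (ψ z - ψ y)) =ᶠ[𝓝 y] (fun u => u - ψ y) ∘ ψ := by
    filter_upwards [χ.eventuallyEq_one] with z hz
    simp [hz]
  have h3 : MDifferentiableAt (𝓡 n) (𝓡 n) ψ y :=
    mdifferentiableAt_extChartAt (mem_chart_source _ _)
  have h4 : HasMFDerivAt (𝓡 n) (𝓡 n) (fun u : EuclideanSpace ℝ (Fin n) => u - ψ y) (ψ y)
      (ContinuousLinearMap.id ℝ (EuclideanSpace ℝ (Fin n))) :=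
    ((hasFDerivAt_id (𝕜 := ℝ) (ψ y)).sub_const (ψ y)).hasMFDerivAt
  have h5 : HasMFDerivAt (𝓡 n) (𝓡 n) (fun z => χ z • (ψ z - ψ y)) y _ :=
    (h4.comp y h3.hasMFDerivAt).congr_of_eventuallyEq h2
  rw [h5.mfderiv]
  have h6 := mfderiv_extChartAt_self (I := 𝓡 n) (x := y)
  exact DFunLike.congr_fun h6 w

variable {n d : ℕ}
  {Y : Type*} [TopologicalSpace Y] [ChartedSpace (EuclideanSpace ℝ (Fin n)) Y]
  {G : Type*} [TopologicalSpace G] [ChartedSpace (EuclideanSpace ℝ (Fin d)) G] [Group G]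
  [LieGroup (𝓡 d) ∞ G]
  {P : Type*} [TopologicalSpace P] [ChartedSpace (EuclideanSpace ℝ (Fin (n + d))) P]
  [MulAction Gᵐᵒᵖ P] {pr : P → Y}

/-- The adjoint bundle has global smooth sections with any given value at a point. -/
theorem IsPrincipalBundle.exists_section (hpr : IsPrincipalBundle n d G pr)
    [IsManifold (𝓡 n) ∞ Y] [T2Space Y] (p : P) (X₀ : GroupLieAlgebra (𝓡 d) G) :
    ∃ X : P → GroupLieAlgebra (𝓡 d) G,
      ContMDiff (𝓡 (n + d)) 𝓘(ℝ, GroupLieAlgebra (𝓡 d) G) ∞ X ∧ X p = X₀ ∧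
      ∀ (q : P) (g : G), X (MulOpposite.op g • q) = Ad g⁻¹ (X q) := by
  obtain ⟨U, Φ, hU, hy, hs, ht, hΦ⟩ := hpr.locally_trivial (pr p)
  obtain ⟨χ, -, hχ⟩ := (SmoothBumpFunction.nhds_basis_tsupport (I := 𝓡 n) (pr p)).mem_iff.1
    (hU.mem_nhds hy)
  -- The fibre coordinate transforms by q·g ↦ (Φ q)₂ g, so the factor Ad (Φ q)₂⁻¹ makes any constant
  -- equivariant. The constant `Ad (Φ p).2 X₀` gives the value `X₀` at `p`, and the invariant cutoff
  -- allows extension by zero.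
  refine ⟨fun q => χ (pr q) • Ad (Φ q).2⁻¹ (Ad (Φ p).2 X₀), ?_, ?_, ?_⟩
  · intro q
    by_cases hq : pr q ∈ tsupport χ
    · have hqs : q ∈ Φ.source := by rw [hs]; exact hχ hq
      have h1 : ContMDiffAt (𝓡 (n + d)) ((𝓡 n).prod (𝓡 d)) ∞ Φ q :=
        Φ.contMDiffOn.contMDiffAt (Φ.open_source.mem_nhds hqs)
      have h2 : ContMDiffAt (𝓡 (n + d)) (𝓡 d) ∞ (fun q => (Φ q).2⁻¹) q :=
        ((contMDiff_inv (𝓡 d) ∞).comp contMDiff_snd).contMDiffAt.comp q h1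
      have h3 : ContMDiffAt (𝓡 (n + d)) 𝓘(ℝ, GroupLieAlgebra (𝓡 d) G) ∞
          (fun q => Ad (Φ q).2⁻¹ (Ad (Φ p).2 X₀)) q :=
        (contMDiff_Ad (Ad (Φ p).2 X₀)).contMDiffAt.comp q h2
      have h4 : ContMDiffAt (𝓡 (n + d)) 𝓘(ℝ, ℝ) ∞ (fun q => χ (pr q)) q :=
        (χ.contMDiff.comp hpr.contMDiff_proj).contMDiffAt
      exact h4.smul h3
    · have h1 : (fun q => χ (pr q) • Ad (Φ q).2⁻¹ (Ad (Φ p).2 X₀)) =ᶠ[𝓝 q] fun _ => 0 := by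
        have h2 : (tsupport χ)ᶜ ∈ 𝓝 (pr q) := (isClosed_tsupport _).isOpen_compl.mem_nhds hq
        filter_upwards [hpr.contMDiff_proj.continuous.continuousAt h2] with z hz
        rw [image_eq_zero_of_notMem_tsupport hz, zero_smul]
      exact contMDiffAt_const.congr_of_eventuallyEq h1
  · dsimp only
    rw [χ.eq_one, one_smul, ← Ad_mul, inv_mul_cancel, Ad_one]
  · intro q g
    dsimp only
    rw [hpr.proj_act, map_smul]
    by_cases hq : pr q ∈ tsupport χ
    · have hqs : q ∈ Φ.source := by rw [hs]; exact hχ hq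
      rw [(hΦ q hqs).2 g, mul_inv_rev, Ad_mul]
    · rw [image_eq_zero_of_notMem_tsupport hq, zero_smul, zero_smul]

end GlobalSections

/-! ### Decomposable forms as determinants -/

section DecomposableForms

variable {n k : ℕ}

/-- The form `dx₁ ∧ … ∧ dx_k` on `ℝⁿ`. -/
def coordinateForm (h : k ≤ n) : EuclideanSpace ℝ (Fin n) [⋀^Fin k]→L[ℝ] ℝ :=
  { (Matrix.detRowAlternating (n := Fin k) (R := ℝ)).compLinearMap
      (LinearMap.pi fun j => (EuclideanSpace.proj (𝕜 := ℝ) (Fin.castLE h j)).toLinearMap) with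
    cont := by
      change Continuous fun w : Fin k → EuclideanSpace ℝ (Fin n) =>
        Matrix.det (Matrix.of fun i j => w i (Fin.castLE h j))
      refine Continuous.matrix_det (continuous_matrix fun i j => ?_)
      exact (EuclideanSpace.proj (𝕜 := ℝ) (Fin.castLE h j)).continuous.comp (continuous_apply i) }

theorem coordinateForm_apply (h : k ≤ n) (w : Fin k → EuclideanSpace ℝ (Fin n)) :
    coordinateForm h w = Matrix.det (Matrix.of fun i j => w i (Fin.castLE h j)) := rfl

theorem coordinateForm_single (h : k ≤ n) :
    coordinateForm h (fun i => EuclideanSpace.single (Fin.castLE h i) 1) = 1 := by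
  rw [coordinateForm_apply]
  convert Matrix.det_one (n := Fin k) (R := ℝ)
  ext i j
  simp [Matrix.one_apply, eq_comm]

/-- `dx₁ ∧ (dx₁ ∧ … ∧ dx_k) = 0`. -/
theorem coordinateForm_wedge_self (h : k ≤ n) (i₀ : Fin k)
    (w : Fin (k + 1) → EuclideanSpace ℝ (Fin n)) :
    ∑ i : Fin (k + 1), (-1 : ℝ) ^ (i : ℕ) * w i (Fin.castLE h i₀) *
      coordinateForm h (i.removeNth w) = 0 := by
  -- Row 0 repeats row `i₀.succ`, so the determinant vanishes; its Laplace expansion along row 0 is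
  -- the wedge sum.
  let M : Matrix (Fin (k + 1)) (Fin (k + 1)) ℝ := Matrix.of fun a j =>
    Fin.cases (motive := fun _ => ℝ) (w j (Fin.castLE h i₀)) (fun a => w j (Fin.castLE h a)) a
  have h1 : M.det = 0 := Matrix.det_zero_of_row_eq (i := 0) (j := i₀.succ)
    (Fin.succ_ne_zero i₀).symm rfl
  rw [Matrix.det_succ_row_zero] at h1
  rw [← h1]
  refine Finset.sum_congr rfl fun i _ => ?_
  congr 1
  rw [coordinateForm_apply, ← Matrix.det_transpose]
  rfl

end DecomposableForms

/-! ### Failure of ellipticity in dimension at least three -/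

section HigherDimensions

open Filter Topology

variable {n d : ℕ}
  {Y : Type*} [TopologicalSpace Y] [ChartedSpace (EuclideanSpace ℝ (Fin n)) Y]
  {G : Type*} [TopologicalSpace G] [ChartedSpace (EuclideanSpace ℝ (Fin d)) G] [Group G]
  {P : Type*} [TopologicalSpace P] [ChartedSpace (EuclideanSpace ℝ (Fin (n + d))) P]
  [MulAction Gᵐᵒᵖ P] {pr : P → Y}

/-- The form `X ⊗ dH₁ ∧ … ∧ dH_k` for a map `H : Y → ℝⁿ` and a section `X` of the adjoint
bundle. -/
def decomposableForm {k : ℕ} (h : k ≤ n) (pr : P → Y) (H : Y → EuclideanSpace ℝ (Fin n))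
    (X : P → GroupLieAlgebra (𝓡 d) G) : AdForm n d G pr k := fun q =>
  ((coordinateForm h).compContinuousLinearMap
    (mfderiv (𝓡 n) (𝓡 n) H (pr q) : TangentSpace (𝓡 n) (pr q) →L[ℝ]
      EuclideanSpace ℝ (Fin n))).smulRight (X q)

omit [MulAction Gᵐᵒᵖ P] in
theorem pullbackForm_decomposableForm {k : ℕ} (h : k ≤ n) {H : Y → EuclideanSpace ℝ (Fin n)}
    (hH : ContMDiff (𝓡 n) (𝓡 n) ∞ H) (hpr : ContMDiff (𝓡 (n + d)) (𝓡 n) ∞ pr)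
    (X : P → GroupLieAlgebra (𝓡 d) G) (q : P) (w : Fin k → TangentSpace (𝓡 (n + d)) q) :
    pullbackForm pr (decomposableForm h pr H X) q w =
      coordinateForm h (fun i => mfderiv (𝓡 (n + d)) (𝓡 n) (H ∘ pr) q (w i)) • X q := by
  rw [mfderiv_comp q ((hH _).mdifferentiableAt (by simp)) ((hpr q).mdifferentiableAt (by simp))]
  rfl

omit [MulAction Gᵐᵒᵖ P] in
theorem smoothFormsOn_decomposableForm {k : ℕ} (h : k ≤ n) [IsManifold (𝓡 (n + d)) ∞ P]
    {H : Y → EuclideanSpace ℝ (Fin n)} (hH : ContMDiff (𝓡 n) (𝓡 n) ∞ H)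
    (hpr : ContMDiff (𝓡 (n + d)) (𝓡 n) ∞ pr) {X : P → GroupLieAlgebra (𝓡 d) G}
    (hX : ContMDiff (𝓡 (n + d)) 𝓘(ℝ, GroupLieAlgebra (𝓡 d) G) ∞ X) (I : Set ℝ) :
    SmoothFormsOn I (fun _ => pullbackForm pr (decomposableForm h pr H X)) := by
  intro p
  let ψ := extChartAt (𝓡 (n + d)) p
  have ho : IsOpen ψ.target := isOpen_extChartAt_target p
  have hc : ContMDiffOn (𝓡 (n + d)) (𝓡 (n + d)) ∞ ψ.symm ψ.target :=
    contMDiffOn_extChartAt_symm p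
  have hK : ContDiffOn ℝ ∞ ((H ∘ pr) ∘ ψ.symm) ψ.target :=
    contMDiffOn_iff_contDiffOn.1 ((hH.comp hpr).comp_contMDiffOn hc)
  have hdK : ContDiffOn ℝ ∞ (fderiv ℝ ((H ∘ pr) ∘ ψ.symm)) ψ.target :=
    hK.fderiv_of_isOpen ho (by simp)
  have hXc : ContDiffOn ℝ ∞ (X ∘ ψ.symm) ψ.target :=
    contMDiffOn_iff_contDiffOn.1 (hX.comp_contMDiffOn hc)
  have hmain : ContDiffOn ℝ ∞ (chartForm (pullbackForm pr (decomposableForm h pr H X)) p)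
      ψ.target := by
    refine contDiffOn_alternating fun w => ?_
    have h0 : ContDiffOn ℝ ∞ (fun u => coordinateForm h
        (fun i => fderiv ℝ ((H ∘ pr) ∘ ψ.symm) u (w i))) ψ.target :=
      (coordinateForm h).toContinuousMultilinearMap.contDiff.comp_contDiffOn
        (contDiffOn_pi.2 fun i => hdK.clm_apply contDiffOn_const)
    have h1 : ContDiffOn ℝ ∞ (fun u => coordinateForm h
        (fun i => fderiv ℝ ((H ∘ pr) ∘ ψ.symm) u (w i)) • X (ψ.symm u)) ψ.target :=
      h0.smul hXc
    refine h1.congr fun u hu => ?_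
    refine (pullbackForm_decomposableForm h hH hpr X (ψ.symm u) _).trans ?_
    congr 2
    funext i
    have hd : MDifferentiableAt (𝓡 (n + d)) (𝓡 (n + d)) ψ.symm u :=
      (hc.contMDiffAt (ho.mem_nhds hu)).mdifferentiableAt (by simp)
    have h2 := mfderiv_comp u (((hH.comp hpr) (ψ.symm u)).mdifferentiableAt (by simp)) hd
    rw [mfderiv_eq_fderiv] at h2
    exact (DFunLike.congr_fun h2 (w i)).symm
  exact hmain.comp contDiffOn_snd fun q hq => hq.2

/-- The map H ∘ pr is invariant under G, so the scalar form is too, and the whole equivariance is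
carried by `X`. -/
theorem IsPrincipalBundle.isAdForm_decomposableForm (hpr : IsPrincipalBundle n d G pr)
    [LieGroup (𝓡 d) ∞ G] {k : ℕ} (h : k ≤ n)
    {H : Y → EuclideanSpace ℝ (Fin n)} (hH : ContMDiff (𝓡 n) (𝓡 n) ∞ H)
    {X : P → GroupLieAlgebra (𝓡 d) G}
    (hX : ∀ (q : P) (g : G), X (MulOpposite.op g • q) = Ad g⁻¹ (X q)) :
    IsAdForm pr (decomposableForm h pr H X) := by
  intro q g w
  have hHp := hH.comp hpr.contMDiff_proj
  have hact : MDifferentiableAt (𝓡 (n + d)) (𝓡 (n + d)) (fun z : P => MulOpposite.op g • z) q := by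
    have h1 : MDifferentiableAt ((𝓡 (n + d)).prod (𝓡 d)) (𝓡 (n + d))
        (fun z : P × G => MulOpposite.op z.2 • z.1) (q, g) :=
      (hpr.contMDiff_act (q, g)).mdifferentiableAt (by simp)
    exact h1.comp (f := fun z : P => (z, g)) q (mdifferentiableAt_id.prodMk mdifferentiableAt_const)
  have hc : (H ∘ pr) ∘ (fun z : P => MulOpposite.op g • z) = H ∘ pr := by
    funext z
    exact congrArg H (hpr.proj_act z g)
  have h2 := mfderiv_comp q ((hHp (MulOpposite.op g • q)).mdifferentiableAt (by simp)) hact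
  rw [hc] at h2
  rw [pullbackForm_decomposableForm h hH hpr.contMDiff_proj,
    pullbackForm_decomposableForm h hH hpr.contMDiff_proj, hX, map_smul]
  congr 2
  funext i
  exact (DFunLike.congr_fun h2 (w i)).symm

theorem isSmoothAdPath_zero [LieGroup (𝓡 d) ∞ G] (I : Set ℝ) {k : ℕ} :
    IsSmoothAdPath pr I (fun _ _ => 0 : ℝ → AdForm n d G pr k) where
  isAdForm _ _ _ g _ := (map_zero (Ad (G := G) g⁻¹)).symm
  smooth _ := contDiffOn_const (c := 0)

variable [LieGroup (𝓡 d) ∞ G] [IsManifold (𝓡 (n + d)) ∞ P] [IsManifold (𝓡 n) ∞ Y] [T2Space Y]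
  [RiemannianBundle (fun y : Y => TangentSpace (𝓡 n) y)]

/-- In dimension at least three the symbol has a kernel: the forms `v` with `ξ ∧ v = 0`. -/
theorem not_isElliptic_linearizedOperator (hpr : IsPrincipalBundle n d G pr)
    (hn : 2 ≤ n) (hn3 : 3 ≤ n) (hd : 0 < d) [Nonempty Y]
    (o : ∀ y : Y, Orientation ℝ (TangentSpace (𝓡 n) y) (Fin n))
    {I : Set ℝ} (hI : IsOpen I) (hIne : I.Nonempty)
    {A : ℝ → ∀ p : P, TangentSpace (𝓡 (n + d)) p →L[ℝ] GroupLieAlgebra (𝓡 d) G}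
    (hA : IsSmoothConnectionPath I A)
    (om : ℝ → AdForm n d G pr (n - 2)) (Ψ : ℝ → AdForm n d G pr 0) :
    ¬ IsElliptic pr I (linearizedOperator hn pr o A om Ψ) := by
  intro hell
  obtain ⟨s, hs⟩ := hIne
  obtain ⟨p, -⟩ := hpr.surjective_proj (Classical.arbitrary Y)
  have hk : n - 2 ≤ n := Nat.sub_le n 2
  -- The degree n - 2 is positive exactly because n ≥ 3: `v` has a factor that the covector can
  -- repeat.
  let i₀ : Fin (n - 2) := ⟨0, by omega⟩
  let j₀ : Fin n := Fin.castLE hk i₀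
  obtain ⟨H, hH, hH0, hHid⟩ := exists_contMDiff_mfderiv_eq_id (n := n) (pr p)
  have hX₀ : ∃ X₀ : GroupLieAlgebra (𝓡 d) G, X₀ ≠ 0 := by
    have : Nonempty (Fin d) := ⟨⟨0, hd⟩⟩
    exact exists_ne (0 : EuclideanSpace ℝ (Fin d))
  obtain ⟨X₀, hX₀⟩ := hX₀
  obtain ⟨X, hX, hXp, hXeq⟩ := hpr.exists_section p X₀
  let v : AdForm n d G pr (n - 2) := decomposableForm hk pr H X
  let u : TripleField n d G pr := fun _ q => (0, v q, 0)
  have hu : IsSmoothTriple pr I u :=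
    { fst := isSmoothAdPath_zero I
      snd := ⟨fun _ _ => hpr.isAdForm_decomposableForm hk hH hXeq,
        smoothFormsOn_decomposableForm hk hH hpr.contMDiff_proj hX I⟩
      thd := isSmoothAdPath_zero I }
  -- The covector is the first factor of `v`. The function does not depend on time, so τ = 0 and the
  -- terms without derivatives along Y disappear.
  let f₀ : Y → ℝ := fun y => H y j₀
  have hf₀ : ContMDiff (𝓡 n) 𝓘(ℝ, ℝ) ∞ f₀ :=
    (EuclideanSpace.proj (𝕜 := ℝ) j₀).contDiff.contMDiff.comp hH
  have hf₀p : f₀ (pr p) = 0 := by simp [f₀, hH0]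
  have hdf₀ : ∀ w : EuclideanSpace ℝ (Fin n), differential f₀ (pr p) w = w j₀ := by
    intro w
    have h1 : HasMFDerivAt (𝓡 n) 𝓘(ℝ, ℝ) (EuclideanSpace.proj (𝕜 := ℝ) j₀ ∘ H) (pr p)
        ((EuclideanSpace.proj (𝕜 := ℝ) j₀ : EuclideanSpace ℝ (Fin n) →L[ℝ] ℝ).comp
          (mfderiv (𝓡 n) (𝓡 n) H (pr p))) :=
      ((EuclideanSpace.proj (𝕜 := ℝ) j₀).hasMFDerivAt (x := H (pr p))).comp (pr p)
        ((hH (pr p)).mdifferentiableAt (by simp)).hasMFDerivAt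
    have h2 := DFunLike.congr_fun h1.mfderiv w
    refine Eq.trans h2 ?_
    exact congrArg (fun z : EuclideanSpace ℝ (Fin n) => z j₀) (hHid w)
  let f : ℝ × Y → ℝ := fun q => f₀ q.2
  have hf : ContMDiff ((𝓘(ℝ, ℝ)).prod (𝓡 n)) 𝓘(ℝ, ℝ) ∞ f := hf₀.comp contMDiff_snd
  have hfne : mfderiv ((𝓘(ℝ, ℝ)).prod (𝓡 n)) 𝓘(ℝ, ℝ) f (s, pr p) ≠ 0 := by
    intro h
    have h1 := mfderiv_prod_eq_add_apply (p := (s, pr p))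
      (v := ((0, EuclideanSpace.single j₀ 1) : ℝ × EuclideanSpace ℝ (Fin n)))
      ((hf (s, pr p)).mdifferentiableAt (by simp))
    rw [h] at h1
    -- On the vector (0, e_{j₀}) the time partial gives 0 and the space partial gives 1.
    have h2 : (0 : ℝ) = 0 + 1 := by
      refine h1.trans (congrArg₂ (fun a b : ℝ => a + b) ?_ ?_)
      · exact map_zero (mfderiv 𝓘(ℝ, ℝ) 𝓘(ℝ, ℝ) (fun z : ℝ => f (z, pr p)) s)
      · refine (hdf₀ (EuclideanSpace.single j₀ 1)).trans ?_
        simp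
    norm_num at h2
  obtain ⟨σ, hσ⟩ := hell s hs p f hf hf₀p hfne
  have hA' := hA.isConnection s hs
  have hτ : HasDerivAt (fun t : ℝ => f (t, pr p)) 0 s := hasDerivAt_const s (f₀ (pr p))
  have hsymb := hσ u hu
  rw [hpr.linearizedOperator_smul_of_eq_zero hn o A om Ψ hI hs hA' hτ hf₀p hu] at hsymb
  have hdv : covExtDeriv pr (A s) (fun q => f (s, pr q) • (u s q).2.1) p = 0 := by
    ext w
    have h1 := hpr.covExtDeriv_smul_of_eq_zero hA' (f := f₀)
      ((hf₀ (pr p)).mdifferentiableAt (by simp)) hf₀p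
      (hu.snd.smooth.continuousAt_space hI hs p) w
    refine h1.trans ?_
    have h2 : ∀ i : Fin (n - 2 + 1), (-1 : ℤ) ^ (i : ℕ) • differential f₀ (pr p) (w i) •
        (u s p).2.1 (i.removeNth w) = ((-1 : ℝ) ^ (i : ℕ) *
          (show EuclideanSpace ℝ (Fin n) from w i) j₀ *
          coordinateForm hk (i.removeNth w)) • X p := by
      intro i
      have h3 : (u s p).2.1 (i.removeNth w) = coordinateForm hk (i.removeNth w) • X p := by
        refine congrArg (fun c : ℝ => c • X p) (congrArg (coordinateForm hk) ?_)
        funext a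
        exact hHid _
      rw [h3, ← Int.cast_smul_eq_zsmul ℝ, smul_smul, smul_smul]
      push_cast
      congr 2
      exact congrArg ((-1 : ℝ) ^ (i : ℕ) * ·) (hdf₀ (w i))
    refine (Finset.sum_congr rfl fun i _ => h2 i).trans ?_
    rw [← Finset.sum_smul]
    exact (congrArg (fun c : ℝ => c • X p) (coordinateForm_wedge_self hk i₀ w)).trans
      (zero_smul ℝ _)
  have hstar : adStar pr o (show 1 + (n - 1) = n by omega)
      (fun _ => 0 : AdForm n d G pr 1) = fun _ => 0 := by
    funext q
    exact hodgeStar_zero _ _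
  have hdz : ∀ k, covExtDeriv pr (A s) (fun q => f (s, pr q) • (0 : AdFibre n d G pr k q)) =
      fun _ => 0 := by
    intro k
    simp only [smul_zero]
    exact covExtDeriv_zero (A s)
  have hzero : σ (u s p) = 0 := by
    rw [← hsymb]
    have hd1 := hdz 1
    have hd0 := hdz 0
    have hd' := hdz (n - 1)
    refine Prod.ext ?_ (Prod.ext ?_ ?_)
    · change (0 : ℝ) • (u s p).1 + (-1 : ℝ) ^ (n + 1) • hodgeStar (o (pr p)) _
        (covExtDeriv pr (A s) (fun q => f (s, pr q) • (u s q).2.1) p) -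
        covExtDeriv pr (A s) (fun q => f (s, pr q) • (0 : AdFibre n d G pr 0 q)) p = 0
      rw [hdv, hd0, hodgeStar_zero, smul_zero, sub_zero, smul_zero, zero_add]
    · change (0 : ℝ) • (u s p).2.1 + hodgeStar (o (pr p)) _
        (covExtDeriv pr (A s) (fun q => f (s, pr q) • (0 : AdFibre n d G pr 1 q)) p) = 0
      rw [hd1, hodgeStar_zero, zero_smul, add_zero]
    · change (0 : ℝ) • (u s p).2.2 + hodgeStar (o (pr p)) _ (covExtDeriv pr (A s)
        (fun q => f (s, pr q) • adStar pr o (show 1 + (n - 1) = n by omega)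
          (fun _ => 0 : AdForm n d G pr 1) q) p) = 0
      rw [hstar, hd', hodgeStar_zero, zero_smul, add_zero]
  -- Injectivity of `σ` would force `v p = 0`, yet on the first n - 2 coordinate vectors this form
  -- takes the value `X₀`.
  have hv0 : v p = 0 := congrArg (fun z => z.2.1) (σ.map_eq_zero_iff.1 hzero)
  refine hX₀ ?_
  have h1 : v p (fun i => EuclideanSpace.single (Fin.castLE hk i) 1) = X₀ := by
    have h2 : v p (fun i => EuclideanSpace.single (Fin.castLE hk i) 1) =
        coordinateForm hk (fun i => EuclideanSpace.single (Fin.castLE hk i) 1) • X p := by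
      refine congrArg (fun c : ℝ => c • X p) (congrArg (coordinateForm hk) ?_)
      funext a
      exact hHid _
    rw [h2, coordinateForm_single, one_smul, hXp]
  rw [← h1, hv0]
  rfl

end HigherDimensions

end

/-- Let `pr : P → Y` be a principal `G`-bundle over a nonempty closed oriented Riemannian manifold of
dimension `n ≥ 2`, where `G` is a compact Lie group of dimension `d > 0`. For every smooth path
`(A, ω, Ψ)` over a nonempty open interval `I`, the operator `∇_s + B_{(A,ω,Ψ)}` is elliptic if and
only if `n = 2`. -/
theorem proposition10p1 {n d : ℕ} (hn : 2 ≤ n) (hd : 0 < d)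
    {Y : Type*} [TopologicalSpace Y] [ChartedSpace (EuclideanSpace ℝ (Fin n)) Y]
    [IsManifold (𝓡 n) ∞ Y] [T2Space Y] [CompactSpace Y] [Nonempty Y]
    [RiemannianBundle (fun y : Y => TangentSpace (𝓡 n) y)]
    [IsContMDiffRiemannianBundle (𝓡 n) ∞ (EuclideanSpace ℝ (Fin n))
      (fun y : Y => TangentSpace (𝓡 n) y)]
    (o : ∀ y : Y, Orientation ℝ (TangentSpace (𝓡 n) y) (Fin n)) (ho : IsManifoldOrientation o)
    {G : Type*} [TopologicalSpace G] [ChartedSpace (EuclideanSpace ℝ (Fin d)) G] [Group G]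
    [LieGroup (𝓡 d) ∞ G] [T2Space G] [CompactSpace G]
    {P : Type*} [TopologicalSpace P] [ChartedSpace (EuclideanSpace ℝ (Fin (n + d))) P]
    [IsManifold (𝓡 (n + d)) ∞ P] [MulAction Gᵐᵒᵖ P]
    (pr : P → Y) (hpr : IsPrincipalBundle n d G pr)
    (I : Set ℝ) (hI : IsOpen I) (hI' : I.OrdConnected) (hI'' : I.Nonempty)
    (A : ℝ → ∀ p : P, TangentSpace (𝓡 (n + d)) p →L[ℝ] GroupLieAlgebra (𝓡 d) G)
    (hA : IsSmoothConnectionPath I A)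
    (om : ℝ → AdForm n d G pr (n - 2)) (hom : IsSmoothAdPath pr I om)
    (Ψ : ℝ → AdForm n d G pr 0) (hΨ : IsSmoothAdPath pr I Ψ) :
    IsElliptic pr I (linearizedOperator hn pr o A om Ψ) ↔ n = 2 := by
  constructor
  · intro h
    by_contra hne
    exact not_isElliptic_linearizedOperator hpr hn (by omega) hd o hI hI'' hA om Ψ h
  · rintro rfl
    exact isElliptic_linearizedOperator_surface hpr o ho hI hA om Ψ
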